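/- Let $\Pi_q$ be an arbitrary finite projective plane of order $q\ge 5$. Identify $\Pi_q$ with its incidence graph, whose vertices are the points and the lines and whose edges are the incident point–line pairs. For a point $P$ let $[P]$ be the set of lines through $P$ (a full pencil), and for a line $\ell$ let $[\ell]$ be the set of points on $\ell$. A set $\mathcal D$ of vertices is *dominating* if every vertex is in $\mathcal D$ or adjacent to an element of $\mathcal D$; it is *minimal* if no proper subset of it is dominating. Write $\mathcal D=\mathcal P_{\mathcal D}\cup\mathcal L_{\mathcal D}$, where $\mathcal P_{\mathcal D}$ is its set of points and $\mathcal L_{\mathcal D}$ its set of lines. A dominating set $\mathcal D$ is *stable* if it is minimal and there is no dominating set $\mathcal D'\supset\mathcal D$ with $|\mathcal D'|=|\mathcal D|+1$ that contains a dominating set of size less than $|\mathcal D|$. It is *primal* if it contains $q$ concurrent lines or $q$ collinear points (possibly a full pencil or a full line). A *blocking set* of $\Pi_q$ is a set of points meeting every line; it is *nontrivial* if it contains no full line. For a line $\ell$, a blocking set of the affine plane $\Pi_q\setminus\ell$ is a set of points not on $\ell$ that meets every line other than $\ell$. Minimality of blocking sets is with respect to inclusion. A *Baer subplane* is a subplane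 of order $\sqrt q$, identified with its set of points. **Theorem 1.2.** Let $\mathcal D$ be a minimal dominating set in the incidence graph of $\Pi_q$, $q\ge5$. If $|\mathcal D|\le 2q+\sqrt q+1$, then $\mathcal D$ is stable. Furthermore (without any bound on $|\mathcal D|$), one of the following holds: * $\mathcal D$ is primal, and one of (i)–(v) holds: * (i) $|\mathcal D|=2q$, and $\mathcal D=([\ell]\setminus\{P\})\cup([P]\setminus\{\ell\})$ for a point $P$ and a line $\ell$ with $P\in\ell$; * (ii) $|\mathcal D|=2q+2$, and $\mathcal D=[\ell]\cup[P]$ for a point $P$ and a line $\ell$ with $P\notin\ell$; * (iii) $|\mathcal D|=2q+\sqrt q+1$, and either (a) there is a Baer subplane $\Pi'$ and a point $P\in\Pi'$ such that $\mathcal L_{\mathcal D}=[P]$ and $\mathcal P_{\mathcal D}=\Pi'\setminus\{P\}$, or (b) $\mathcal D$ is the dual of the structure described in (a); * (iv) $2q+\sqrt q+1<|\mathcal D|<3q-1$; moreover, if $\mathcal D$ is stable, then (a) $\mathcal L_{\mathcal D}$ is a full pencil and $\mathcal P_{\mathcal D}$ consists of all but possibly one point of a nontrivial minimal blocking set of $\Pi_q$,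 or (b) $\mathcal L_{\mathcal D}$ is a full pencil plus a line $\ell$ not in that pencil, and $\mathcal P_{\mathcal D}$ consists of all but possibly one point of a minimal blocking set of the affine plane $\Pi_q\setminus\ell$, or (c) $\mathcal D$ is the dual of the structure described in (a) or (b); * (v) $|\mathcal D|\ge 3q-1$. * $\mathcal D$ is not primal, and * (vi) $|\mathcal D|\ge 2q+2\lfloor\sqrt q\rfloor+2$, provided that $q>81$. -/

import Mathlib

open Configuration Configuration.ProjectivePlane

namespace DomPlane

section Graph

variable {V : Type*}

/-- A set `D` of vertices is dominating if every vertex is in `D` or has a neighbour in `D`. -/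
def IsDominating (G : SimpleGraph V) (D : Set V) : Prop :=
  ∀ v, v ∈ D ∨ ∃ u ∈ D, G.Adj u v

/-- A (finite) dominating set `D` is stable if it is minimal and no dominating set `D' ⊃ D` with
`|D'| = |D| + 1` contains a dominating set of size less than `|D|`. -/
def IsStable (G : SimpleGraph V) (D : Set V) : Prop :=
  Minimal (IsDominating G) D ∧
    ¬ ∃ D' : Set V, IsDominating G D' ∧ D ⊂ D' ∧ D'.ncard = D.ncard + 1 ∧
      ∃ E ⊆ D', IsDominating G E ∧ E.ncard < D.ncard

end Graph

section Plane

/-- The incidence graph: vertices are points and lines, and adjacency is incidence. -/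
def incidenceGraph (P L : Type*) [Membership P L] : SimpleGraph (P ⊕ L) where
  Adj
    | Sum.inl p, Sum.inr l => p ∈ l
    | Sum.inr l, Sum.inl p => p ∈ l
    | _, _ => False
  symm := ⟨by rintro (p | l) (p' | l') h <;> exact h⟩
  loopless := ⟨by rintro (p | l) h <;> exact h⟩

variable {P L : Type*} [Membership P L]

/-- The points of a vertex set of the incidence graph. -/
def points (D : Set (P ⊕ L)) : Set P := {p | Sum.inl p ∈ D}

/-- The lines of a vertex set of the incidence graph. -/
def lines (D : Set (P ⊕ L)) : Set L := {l | Sum.inr l ∈ D}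

variable (L) in
/-- The pencil `[p]`: all lines through the point `p`. -/
def pencil (p : P) : Set L := {l | p ∈ l}

variable (P) in
/-- The set `[l]` of all points on the line `l`. -/
def range (l : L) : Set P := {p | p ∈ l}

variable (L) in
/-- A blocking set: a set of points meeting every line. -/
def IsBlocking (B : Set P) : Prop := ∀ l : L, ∃ p ∈ B, p ∈ l

variable (L) in
/-- A nontrivial minimal blocking set: minimal, and containing no full line. -/
def IsNontrivialMinimalBlocking (B : Set P) : Prop :=
  Minimal (IsBlocking L) B ∧ ∀ l : L, ¬ range P l ⊆ B

/-- A blocking set of the affine plane obtained by deleting the line `l` and its points: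
a set of points off `l` that meets every line other than `l`. -/
def IsAffineBlocking (l : L) (B : Set P) : Prop :=
  (∀ p ∈ B, p ∉ l) ∧ ∀ m : L, m ≠ l → ∃ p ∈ B, p ∈ m

/-- `S` consists of all but possibly one point of `B`. -/
def AllButAtMostOne (S B : Set P) : Prop := S ⊆ B ∧ (B \ S).encard ≤ 1

/-- The points `S` and the lines `T`, with the induced incidence, form a projective plane
of order `n`. -/
def IsSubplane (S : Set P) (T : Set L) (n : ℕ) : Prop :=
  letI : Membership S T := ⟨fun l p => (p : P) ∈ (l : L)⟩
  ∃ _ : ProjectivePlane S T, order S T = n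

/-- The lines are a full pencil, and the points are all but possibly one point of a nontrivial
minimal blocking set. -/
def IsProjectiveBlockingType (S : Set P) (T : Set L) : Prop :=
  (∃ p : P, T = pencil L p) ∧
    ∃ B : Set P, IsNontrivialMinimalBlocking L B ∧ AllButAtMostOne S B

/-- The lines are a full pencil plus one more line `l`, and the points are all but possibly one
point of a minimal blocking set of the affine plane obtained by deleting `l`. -/
def IsAffineBlockingType (S : Set P) (T : Set L) : Prop :=
  ∃ l : L, (∃ p : P, p ∉ l ∧ T = pencil L p ∪ {l}) ∧
    ∃ B : Set P, Minimal (IsAffineBlocking l) B ∧ AllButAtMostOne S B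

variable [ProjectivePlane P L]

variable (L) in
/-- `B` is the point set of a Baer subplane, that is, of a subplane of order `√q`, where `q` is
the order of the plane. -/
def IsBaerSubplane (B : Set P) : Prop :=
  ∃ (T : Set L) (n : ℕ), n ^ 2 = order P L ∧ IsSubplane B T n

/-- `D` contains (at least) `q` concurrent lines or (at least) `q` collinear points. -/
def IsPrimal (D : Set (P ⊕ L)) : Prop :=
  (∃ p : P, order P L ≤ (pencil L p ∩ lines D).ncard) ∨
    (∃ l : L, order P L ≤ (range P l ∩ points D).ncard)

/-- The points are a Baer subplane minus one of its points `p`, and the lines are the full pencil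
of `p`. -/
def IsBaerType (S : Set P) (T : Set L) : Prop :=
  ∃ (B : Set P) (p : P), IsBaerSubplane L B ∧ p ∈ B ∧ T = pencil L p ∧ S = B \ {p}

end Plane

end DomPlane

/-! Write a dominating set as a pair of a point set `A` and a line set `B`, and let the degree of a
point be the number of lines of `B` through it. Points of degree zero must lie in `A`, so bounds on
the number of uncovered points become bounds on `|A|`. All estimates come from counting degrees
along lines, and from the quadratic sum of (degree − 1)(m − degree). Every statement about `B` is
applied to `A` by passing to the dual plane.

Primal case. Suppose that `q` lines of `B` pass through a point `x`. If exactly one line of the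
pencil is missing, its points other than `x` must all lie in `A`, giving (i), or the set has at
least `3q − 1` elements. If the whole pencil is present, `C = A ∪ {x}` meets every line except the
extra lines of `B` off `x`. Either `C` contains a full line, giving (ii), or a version of Bruen's
inequality with `r` skew lines applies (`bruen_skew`); equality with `r = 0` forces a Baer subplane.
The number of extra lines decides the shape: none gives a projective blocking set, one an affine
blocking set, and two make the set unstable, since two extra lines can be exchanged for their
intersection point.

Non-primal case. By `mul_le_card_unc` a degree at most `q − 1` is in fact small, and then the
quadratic sum excludes all but a narrow numerical window near `q = s²`, where `|B| = q + s`
(`TightPair`). There, most lines of `B` consist of `s + 1` points of nearly maximal degree and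
otherwise points of degree one. Every point of intermediate degree must lie in `A`
(`TightPair.mem_of_mid`), which leaves too little room in `A`.

Stability. A smaller dominating set `E` inside `D` plus one vertex has size at most `2q + ⌊√q⌋`,
hence is one of the two smallest primal examples or a six-plus-six configuration in a plane of order
five. In the first case `D` is primal and its classification gives a contradiction; in the second,
more than one vertex of `D` outside `E` is needed to compensate for the vertex of `E` that is
missing from `D`. -/

namespace DomPlane

set_option linter.unusedSectionVars false

/-! ### Degrees and double counting in a projective plane -/

section Counting

open Finset HasPoints HasLines Nondegenerate
open scoped Classical

variable {P L : Type*} [Membership P L] [Fintype P] [Fintype L]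

variable (P) in
/-- The points of a line, as a finset. -/
noncomputable def pts (l : L) : Finset P := univ.filter (· ∈ l)

variable (L) in
/-- The lines through a point, as a finset. -/
noncomputable def lns (p : P) : Finset L := univ.filter (p ∈ ·)

/-- The number of points of `A` on the line `l`. -/
noncomputable def pdeg (A : Finset P) (l : L) : ℤ := ∑ p ∈ A, if p ∈ l then 1 else 0

/-- The number of lines of `B` through the point `p`. -/
noncomputable def ldeg (B : Finset L) (p : P) : ℤ := ∑ l ∈ B, if p ∈ l then 1 else 0

@[simp] theorem mem_pts {l : L} {p : P} : p ∈ pts P l ↔ p ∈ l := by simp [pts]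

@[simp] theorem mem_lns {l : L} {p : P} : l ∈ lns L p ↔ p ∈ l := by simp [lns]

theorem pdeg_eq_card (A : Finset P) (l : L) : pdeg A l = (A.filter (· ∈ l)).card := by
  simp [pdeg]

theorem ldeg_eq_card (B : Finset L) (p : P) : ldeg B p = (B.filter (p ∈ ·)).card := by
  simp [ldeg]

theorem pdeg_nonneg (A : Finset P) (l : L) : 0 ≤ pdeg A l := by simp [pdeg_eq_card]

theorem ldeg_nonneg (B : Finset L) (p : P) : 0 ≤ ldeg B p := by simp [ldeg_eq_card]

theorem one_le_ldeg_iff {B : Finset L} {p : P} : 1 ≤ ldeg B p ↔ ∃ l ∈ B, p ∈ l := by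
  rw [ldeg_eq_card]
  have : (1 : ℤ) ≤ ((B.filter (p ∈ ·)).card : ℤ) ↔ 0 < (B.filter (p ∈ ·)).card := by omega
  rw [this, card_pos]
  simp [Finset.Nonempty]

theorem one_le_pdeg_iff {A : Finset P} {l : L} : 1 ≤ pdeg A l ↔ ∃ p ∈ A, p ∈ l :=
  one_le_ldeg_iff (P := Dual L) (L := Dual P)

theorem ldeg_eq_zero_iff {B : Finset L} {p : P} : ldeg B p = 0 ↔ ∀ l ∈ B, p ∉ l := by
  have h := one_le_ldeg_iff (B := B) (p := p)
  have h0 := ldeg_nonneg B p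
  constructor
  · intro h1 l hl hp
    have := h.2 ⟨l, hl, hp⟩
    omega
  · intro h1
    by_contra h2
    obtain ⟨l, hl, hp⟩ := h.1 (by omega)
    exact h1 l hl hp

theorem pdeg_eq_zero_iff {A : Finset P} {l : L} : pdeg A l = 0 ↔ ∀ p ∈ A, p ∉ l :=
  ldeg_eq_zero_iff (P := Dual L) (L := Dual P)

theorem pdeg_eq_sum_pts (A : Finset P) (l : L) :
    pdeg A l = ∑ p ∈ pts P l, if p ∈ A then 1 else 0 := by
  rw [pdeg_eq_card, sum_boole]
  congr 2
  ext p
  simp only [mem_filter, mem_pts]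
  exact and_comm

theorem sum_lines_sum_pts {M : Type*} [AddCommMonoid M] (B : Finset L) (f : P → M) :
    ∑ l ∈ B, ∑ p ∈ pts P l, f p = ∑ p, (B.filter (p ∈ ·)).card • f p := by
  simp only [pts, sum_filter]
  rw [sum_comm]
  refine sum_congr rfl fun p _ => ?_
  rw [← sum_filter, sum_const]

theorem sum_lines_sum_pts_int (B : Finset L) (f : P → ℤ) :
    ∑ l ∈ B, ∑ p ∈ pts P l, f p = ∑ p, ldeg B p * f p := by
  rw [sum_lines_sum_pts]
  refine sum_congr rfl fun p _ => ?_
  rw [ldeg_eq_card]; simp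

variable [ProjectivePlane P L]

variable (L) in
theorem card_lns (p : P) : (lns L p).card = order P L + 1 := by
  rw [← lineCount_eq L p, lineCount, Nat.card_eq_fintype_card, Fintype.card_subtype, lns]

variable (P) in
theorem card_pts (l : L) : (pts P l).card = order P L + 1 := by
  rw [← pointCount_eq P l, pointCount, Nat.card_eq_fintype_card, Fintype.card_subtype, pts]

theorem sum_pts_mem {l m : L} (h : l ≠ m) :
    ∑ p ∈ pts P m, (if p ∈ l then (1 : ℤ) else 0) = 1 := by
  obtain ⟨p, ⟨h1, h2⟩, h3⟩ := HasPoints.existsUnique_point P L l m h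
  rw [sum_boole]
  have : (pts P m).filter (· ∈ l) = {p} := by
    ext z
    simp only [mem_filter, mem_pts, mem_singleton]
    exact ⟨fun hz => h3 z ⟨hz.2, hz.1⟩, fun hz => hz ▸ ⟨h2, h1⟩⟩
  simp [this]

theorem sum_pts_ldeg (B : Finset L) (m : L) :
    ∑ p ∈ pts P m, ldeg B p = B.card + if m ∈ B then (order P L : ℤ) else 0 := by
  simp only [ldeg]
  rw [sum_comm]
  have : ∀ l ∈ B, ∑ p ∈ pts P m, (if p ∈ l then (1 : ℤ) else 0) =
      1 + if m = l then (order P L : ℤ) else 0 := by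
    intro l _
    split_ifs with h
    · subst h
      rw [sum_boole]
      have : (pts P m).filter (· ∈ m) = pts P m := by ext; simp
      rw [this, card_pts]; push_cast; ring
    · rw [sum_pts_mem (Ne.symm h)]; simp
  rw [sum_congr rfl this, sum_add_distrib]
  simp

theorem sum_ldeg (B : Finset L) : ∑ p : P, ldeg B p = B.card * (order P L + 1) := by
  have := sum_lines_sum_pts_int (P := P) B (fun _ => 1)
  simp only [mul_one, sum_const, card_pts] at this
  rw [← this]; simp

/-- Each line of `B` meets every other line of `B` once and itself in `q + 1` points. -/
theorem sum_ldeg_sq (B : Finset L) :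
    ∑ p : P, ldeg B p * ldeg B p = B.card * (B.card + order P L) := by
  rw [← sum_lines_sum_pts_int, sum_congr rfl (fun l hl => by rw [sum_pts_ldeg, if_pos hl])]
  simp

/-- The pencil of `x` covers every other point once and `x` itself `q + 1` times. -/
theorem sum_lns_sum_pts (x : P) (f : P → ℤ) :
    ∑ m ∈ lns L x, ∑ p ∈ pts P m, f p = ∑ p, f p + order P L * f x := by
  rw [sum_lines_sum_pts_int]
  have : ∀ p : P, ldeg (lns L x) p * f p = f p + if p = x then (order P L : ℤ) * f p else 0 := by
    intro p
    split_ifs with h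
    · subst h
      rw [ldeg_eq_card]
      have : (lns L p).filter (p ∈ ·) = lns L p := by ext; simp
      rw [this, card_lns]; push_cast; ring
    · have := sum_pts_mem (P := Dual L) (L := Dual P) (l := p) (m := x) h
      have h2 : ldeg (lns L x) p = 1 := this
      rw [h2]; ring
  rw [sum_congr rfl (fun p _ => this p), sum_add_distrib]
  simp

theorem sum_lns_pdeg (A : Finset P) (x : P) :
    ∑ l ∈ lns L x, pdeg A l = A.card + if x ∈ A then (order P L : ℤ) else 0 := by
  have := sum_pts_ldeg (P := Dual L) (L := Dual P) A x
  rw [Dual.order] at this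
  exact this

variable (P L) in
theorem card_points_int : ((univ : Finset P).card : ℤ) = (order P L : ℤ) ^ 2 + order P L + 1 := by
  rw [card_univ, card_points P L]; push_cast; ring

theorem eq_of_mem_mem {l m : L} {p r : P} (h1 : p ∈ l) (h2 : r ∈ l) (h3 : p ∈ m) (h4 : r ∈ m)
    (h : l ≠ m) : p = r := (eq_or_eq h1 h2 h3 h4).resolve_right h

theorem line_eq_of_mem_mem {l m : L} {p r : P} (h1 : p ∈ l) (h2 : r ∈ l) (h3 : p ∈ m) (h4 : r ∈ m)
    (h : p ≠ r) : l = m := (eq_or_eq h1 h2 h3 h4).resolve_left h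

variable (L) in
theorem exists_line_mem (p r : P) : ∃ l : L, p ∈ l ∧ r ∈ l := by
  by_cases h : p = r
  · subst h
    have : (lns L p).Nonempty := by rw [← card_pos, card_lns]; omega
    obtain ⟨l, hl⟩ := this
    exact ⟨l, by simpa using hl, by simpa using hl⟩
  · exact ⟨_, HasLines.mkLine_ax h⟩

variable (P) in
theorem exists_point_mem (l m : L) : ∃ p : P, p ∈ l ∧ p ∈ m :=
  exists_line_mem (Dual P) (P := Dual L) l m

/-- Two points are joined by a line of `B`. -/
def Joined (B : Finset L) (p r : P) : Prop := ∃ l ∈ B, p ∈ l ∧ r ∈ l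

theorem Joined.symm {B : Finset L} {p r : P} (h : Joined B p r) : Joined B r p := by
  obtain ⟨l, h1, h2, h3⟩ := h
  exact ⟨l, h1, h3, h2⟩

/-- Since `x` is off `l`, distinct lines through `x` meet `l` in distinct points. -/
theorem card_joined (B : Finset L) {x : P} {l : L} (h : x ∉ l) :
    (((pts P l).filter (Joined B x)).card : ℤ) = ldeg B x := by
  rw [ldeg_eq_card, Nat.cast_inj]
  symm
  choose f hf1 hf2 using fun m : L => exists_point_mem P l m
  refine card_bij (fun m _ => f m) ?_ ?_ ?_
  · intro m hm
    simp only [mem_filter] at hm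
    simp only [mem_filter, mem_pts]
    exact ⟨hf1 m, m, hm.1, hm.2, hf2 m⟩
  · intro m hm m' hm' he
    simp only [mem_filter] at hm hm'
    have hne : x ≠ f m := fun h' => h (h' ▸ hf1 m)
    exact line_eq_of_mem_mem hm.2 (hf2 m) hm'.2 (he ▸ hf2 m') hne
  · intro z hz
    simp only [mem_filter, mem_pts] at hz
    obtain ⟨hz, m, hm, hxm, hzm⟩ := hz
    refine ⟨m, by simp [hm, hxm], ?_⟩
    have hne : l ≠ m := fun h' => h (h' ▸ hxm)
    exact eq_of_mem_mem (hf1 m) hz (hf2 m) hzm hne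

end Counting

/-! ### Dominating pairs and lower bounds from uncovered points -/

section Bounds

open Finset HasPoints HasLines Nondegenerate
open scoped Classical

variable {P L : Type*} [Membership P L] [Fintype P] [Fintype L]

/-- The vertex set consisting of the points `A` and the lines `B` is dominating. -/
def Dom (A : Finset P) (B : Finset L) : Prop :=
  (∀ p, p ∉ A → ∃ l ∈ B, p ∈ l) ∧ ∀ l, l ∉ B → ∃ p ∈ A, p ∈ l

theorem Dom.dual {A : Finset P} {B : Finset L} (h : Dom A B) :
    Dom (P := Dual L) (L := Dual P) B A := ⟨h.2, h.1⟩

/-- The points on no line of `B`. -/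
noncomputable def unc (P : Type*) {L : Type*} [Membership P L] [Fintype P] (B : Finset L) :
    Finset P := univ.filter (ldeg B · = 0)

@[simp] theorem mem_unc {B : Finset L} {p : P} : p ∈ unc P B ↔ ldeg B p = 0 := by simp [unc]

theorem Dom.unc_subset {A : Finset P} {B : Finset L} (h : Dom A B) : unc P B ⊆ A := by
  intro p hp
  by_contra hA
  rw [mem_unc, ldeg_eq_zero_iff] at hp
  obtain ⟨l, hl, hpl⟩ := h.1 p hA
  exact hp l hl hpl

theorem Dom.card_unc_le {A : Finset P} {B : Finset L} (h : Dom A B) :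
    ((unc P B).card : ℤ) ≤ A.card := by
  exact_mod_cast card_le_card h.unc_subset

theorem Dom.mono {A A' : Finset P} {B B' : Finset L} (h : Dom A B) (hA : A ⊆ A') (hB : B ⊆ B') :
    Dom A' B' := by
  refine ⟨fun p hp => ?_, fun l hl => ?_⟩
  · obtain ⟨l, h1, h2⟩ := h.1 p (fun h' => hp (hA h'))
    exact ⟨l, hB h1, h2⟩
  · obtain ⟨l, h1, h2⟩ := h.2 l (fun h' => hl (hB h'))
    exact ⟨l, hA h1, h2⟩

variable [ProjectivePlane P L]

theorem card_lns_sdiff (B : Finset L) (x : P) :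
    ((lns L x \ B).card : ℤ) = order P L + 1 - ldeg B x := by
  have h1 := card_sdiff_add_card_inter (lns L x) B
  have h2 : lns L x ∩ B = B.filter (x ∈ ·) := by
    ext l; simp [and_comm]
  rw [h2, card_lns] at h1
  rw [ldeg_eq_card]
  have : (((lns L x \ B).card + (B.filter (x ∈ ·)).card : ℕ) : ℤ) = (order P L + 1 : ℕ) := by
    rw [h1]
  push_cast at this
  linarith

theorem ldeg_le (B : Finset L) (x : P) : ldeg B x ≤ order P L + 1 := by
  have := card_lns_sdiff B x
  have h : (0 : ℤ) ≤ ((lns L x \ B).card : ℤ) := by positivity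
  linarith

theorem sum_pts_sub_one (B : Finset L) {m : L} (h : m ∉ B) :
    ∑ p ∈ pts P m, (ldeg B p - 1) = B.card - (order P L + 1) := by
  rw [sum_sub_distrib, sum_pts_ldeg, if_neg h]
  simp [card_pts]

/-- Let `k` be the degree of `x`. Each of the `q + 1 - k` lines through `x` outside `B` is met away
from `x` by only `|B| - k` lines of `B`, so at least `q + k - |B|` of its points are uncovered.
These lines share only `x`, which is not counted. -/
theorem mul_le_card_unc (B : Finset L) (x : P) :
    (order P L + 1 - ldeg B x) * (order P L + ldeg B x - B.card) ≤ (unc P B).card := by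
  set g : P → ℤ := fun p => if p ≠ x ∧ ldeg B p = 0 then 1 else 0 with hg
  have hg0 : ∀ p, 0 ≤ g p := fun p => by simp only [hg]; split_ifs <;> norm_num
  have hgx : g x = 0 := by simp [hg]
  have h1 : ∑ m ∈ lns L x \ B, ∑ p ∈ pts P m, g p ≤ ∑ p, g p := by
    have := sum_lns_sum_pts (L := L) x g
    rw [hgx, mul_zero, add_zero] at this
    rw [← this]
    exact sum_le_sum_of_subset_of_nonneg sdiff_subset
      (fun m _ _ => sum_nonneg fun p _ => hg0 p)
  have h2 : ∑ p, g p ≤ (unc P B).card := by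
    simp only [hg]
    rw [sum_boole]
    norm_cast
    refine card_le_card fun p hp => ?_
    simp only [mem_filter] at hp
    simp [hp.2.2]
  have h3 : ∀ m ∈ lns L x \ B,
      (order P L + ldeg B x - B.card : ℤ) ≤ ∑ p ∈ pts P m, g p := by
    intro m hm
    simp only [mem_sdiff, mem_lns] at hm
    have e1 := sum_pts_sub_one (P := P) B hm.2
    have e2 : ∑ p ∈ pts P m, (if p = x then ldeg B x - 1 else 0) = ldeg B x - 1 := by
      rw [sum_ite_eq', if_pos (by simpa using hm.1)]
    have e3 : ∑ p ∈ pts P m, ((if p = x then ldeg B x - 1 else 0) - (ldeg B p - 1)) ≤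
        ∑ p ∈ pts P m, g p := by
      refine sum_le_sum fun p _ => ?_
      have := ldeg_nonneg B p
      simp only [hg]
      by_cases hpx : p = x
      · simp [hpx]
      · by_cases h0 : ldeg B p = 0
        · simp [hpx, h0]
        · simp only [hpx, h0, if_false, and_false]; omega
    rw [sum_sub_distrib, e1, e2] at e3
    linarith
  have h4 := sum_le_sum h3
  rw [sum_const, nsmul_eq_mul, card_lns_sdiff] at h4
  linarith

/-- The quadratic counting identity for the degrees with respect to a set of lines. -/
theorem sum_quad (B : Finset L) (m : ℤ) :
    ∑ p : P, (ldeg B p - 1) * (m - ldeg B p) =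
      -(B.card * (B.card + order P L)) + (m + 1) * (B.card * (order P L + 1)) -
        m * ((order P L : ℤ) ^ 2 + order P L + 1) := by
  have : ∀ p : P, (ldeg B p - 1) * (m - ldeg B p) =
      -(ldeg B p * ldeg B p) + (m + 1) * ldeg B p - m := fun p => by ring
  rw [sum_congr rfl (fun p _ => this p), sum_sub_distrib, sum_add_distrib, sum_neg_distrib,
    sum_ldeg_sq, ← mul_sum, sum_ldeg, sum_const, nsmul_eq_mul, card_points_int P L]
  ring

/-- An uncovered point contributes `-m` to the full sum. What is left is nonnegative as soon as `m`
bounds all degrees. -/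
theorem sum_quad_covered (B : Finset L) (m : ℤ) :
    ∑ p : P, (if ldeg B p = 0 then 0 else (ldeg B p - 1) * (m - ldeg B p)) =
      m * (unc P B).card - B.card * (B.card + order P L) + (m + 1) * (B.card * (order P L + 1)) -
        m * ((order P L : ℤ) ^ 2 + order P L + 1) := by
  have : ∀ p : P, (if ldeg B p = 0 then 0 else (ldeg B p - 1) * (m - ldeg B p)) =
      (ldeg B p - 1) * (m - ldeg B p) + m * if ldeg B p = 0 then 1 else 0 := by
    intro p
    split_ifs with h
    · rw [h]; ring
    · ring
  rw [sum_congr rfl (fun p _ => this p), sum_add_distrib, sum_quad, ← mul_sum, sum_boole, unc]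
  ring

/-- If no point is on more than `m` lines of `B`, the quadratic form gives a bound. -/
theorem quad_nonneg (B : Finset L) (m : ℤ) (h : ∀ p : P, ldeg B p ≤ m) :
    0 ≤ m * (unc P B).card - B.card * (B.card + order P L) + (m + 1) * (B.card * (order P L + 1)) -
        m * ((order P L : ℤ) ^ 2 + order P L + 1) := by
  rw [← sum_quad_covered]
  refine sum_nonneg fun p _ => ?_
  split_ifs with h0
  · exact le_rfl
  · have := ldeg_nonneg B p
    exact mul_nonneg (by omega) (by linarith [h p])

/-- A dominating set with fewer than `q` lines is large. -/
theorem Dom.card_ge_of_lines_lt {A : Finset P} {B : Finset L} (h : Dom A B)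
    (hB : (B.card : ℤ) ≤ order P L) :
    order P L * (order P L + 1 - B.card) ≤ (A.card : ℤ) := by
  have hq : (1 : ℤ) < order P L := by exact_mod_cast one_lt_order P L
  refine le_trans ?_ h.card_unc_le
  rcases B.eq_empty_or_nonempty with rfl | ⟨l, hl⟩
  · have : unc P (∅ : Finset L) = univ := by
      ext p; simp [ldeg]
    rw [this, card_points_int P L]
    simp; nlinarith
  · obtain ⟨x, hx⟩ : (pts P l).Nonempty := by rw [← card_pos, card_pts]; omega
    have h1 : 1 ≤ ldeg B x := one_le_ldeg_iff.2 ⟨l, hl, by simpa using hx⟩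
    have h2 : ldeg B x ≤ B.card := by
      rw [ldeg_eq_card]; exact_mod_cast card_filter_le _ _
    -- The bound is concave in the degree of `x` and takes the same value `q (q + 1 - |B|)` at
    -- degrees `1` and `|B|`.
    have := mul_le_card_unc B x
    nlinarith

/-- With `b < q` lines the size is at least `q (q + 1 - b) + b`, which decreases in `b` and equals
`3q - 1` at `b = q - 1`. -/
theorem Dom.lines_ge {A : Finset P} {B : Finset L} (h : Dom A B)
    (hs : (A.card + B.card : ℤ) < 3 * order P L - 1) : (order P L : ℤ) ≤ B.card := by
  by_contra hB
  push Not at hB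
  have hq : (1 : ℤ) < order P L := by exact_mod_cast one_lt_order P L
  have := h.card_ge_of_lines_lt hB.le
  nlinarith

theorem Dom.points_ge {A : Finset P} {B : Finset L} (h : Dom A B)
    (hs : (A.card + B.card : ℤ) < 3 * order P L - 1) : (order P L : ℤ) ≤ A.card := by
  have := h.dual.lines_ge (by rw [Dual.order, add_comm]; exact hs)
  rwa [Dual.order] at this

theorem Dom.two_mul_order_le {A : Finset P} {B : Finset L} (h : Dom A B) :
    2 * (order P L : ℤ) ≤ A.card + B.card := by
  have hq : (1 : ℤ) < order P L := by exact_mod_cast one_lt_order P L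
  by_contra hlt
  push Not at hlt
  have h1 := h.lines_ge (by linarith)
  have h2 := h.points_ge (by linarith)
  linarith

/-- In a non-primal dominating set the concurrency is either small or at least `q`. -/
theorem Dom.ldeg_le {A : Finset P} {B : Finset L} (h : Dom A B) {s s' : ℤ}
    (hB : (B.card : ℤ) = order P L + s) (hA : (A.card : ℤ) = order P L + s')
    (hq : 2 * s + s' + 3 ≤ order P L) {x : P} (hx : ldeg B x ≤ order P L - 1) :
    ldeg B x ≤ s + 1 := by
  by_contra hlt
  push Not at hlt
  -- The bound `(q + 1 - k)(k - s)` is concave in the degree `k` and equals `2(q - s - 1) > q + s'`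
  -- at both ends `k = s + 2` and `k = q - 1`.
  have h1 := mul_le_card_unc B x
  have h2 := h.card_unc_le
  nlinarith [mul_nonneg (sub_nonneg.2 hx) (by omega : (0 : ℤ) ≤ ldeg B x - (s + 2))]

end Bounds

/-! ### Small non-primal sets and the exceptional configuration in order five -/

section SmallNonprimal

open Finset HasPoints HasLines Nondegenerate
open scoped Classical

variable {P L : Type*} [Membership P L] [Fintype P] [Fintype L] [ProjectivePlane P L]

theorem quad_ineq {A : Finset P} {B : Finset L} (h : Dom A B) {s s' : ℤ} (hs : 0 ≤ s)
    (hB : (B.card : ℤ) = order P L + s) (hA : (A.card : ℤ) = order P L + s')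
    (hdeg : ∀ x : P, ldeg B x ≤ s + 1) :
    (order P L : ℤ) ^ 2 ≤ (s ^ 2 + 2) * order P L + (s + 1) * s' + s - 1 := by
  have h1 := quad_nonneg B (s + 1) hdeg
  have h2 := h.card_unc_le
  rw [hB] at h1
  rw [hA] at h2
  nlinarith

/-- Here `4s² ≤ q`, which contradicts the bound of roughly `q ≤ s² + 2` in `quad_ineq`. The
numerical hypothesis of `Dom.ldeg_le` fails only for `q = 5`, `s = s' = 1`. -/
theorem small_nonprimal_half {A : Finset P} {B : Finset L} (h : Dom A B) {s s' : ℤ} (hs : 0 ≤ s)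
    (hss : s ≤ s') (hB : (B.card : ℤ) = order P L + s) (hA : (A.card : ℤ) = order P L + s')
    (hn : (s + s') ^ 2 ≤ order P L) (hq5 : 5 ≤ order P L)
    (hnp : ∀ x : P, ldeg B x ≤ order P L - 1) : order P L = 5 ∧ s = 1 ∧ s' = 1 := by
  have hq : (5 : ℤ) ≤ order P L := by exact_mod_cast hq5
  by_cases hc : 2 * s + s' + 3 ≤ order P L
  · exfalso
    have h1 := quad_ineq h hs hB hA (fun x => h.ldeg_le hB hA hc (hnp x))
    nlinarith [sq_nonneg (s + s' - 2), sq_nonneg (s - s'), mul_nonneg hs (sub_nonneg.2 hss)]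
  · push Not at hc
    have h5 : order P L = 5 := by
      by_contra h5
      have h6 : (6 : ℤ) ≤ order P L := by
        have : 6 ≤ order P L := by omega
        exact_mod_cast this
      have h7 : s + s' < 3 ∨ 3 ≤ s + s' := lt_or_ge _ _
      rcases h7 with h7 | h7
      · omega
      · nlinarith
    refine ⟨h5, ?_⟩
    rw [h5] at hc hn
    have h6 : s + s' < 3 := by nlinarith
    push_cast at hc
    omega

/-- The only possible non-primal dominating sets of size at most `2q + √q` consist of six points
and six lines in a plane of order five. -/
theorem small_nonprimal {A : Finset P} {B : Finset L} (h : Dom A B) {n : ℤ}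
    (hn : (A.card : ℤ) + B.card = 2 * order P L + n) (hnq : n ^ 2 ≤ order P L)
    (hq5 : 5 ≤ order P L) (hB : ∀ x : P, ldeg B x ≤ order P L - 1)
    (hA : ∀ l : L, pdeg A l ≤ order P L - 1) :
    order P L = 5 ∧ A.card = 6 ∧ B.card = 6 := by
  have hq : (5 : ℤ) ≤ order P L := by exact_mod_cast hq5
  have hlt : (A.card + B.card : ℤ) < 3 * order P L - 1 := by nlinarith
  have h1 := h.lines_ge hlt
  have h2 := h.points_ge hlt
  have h3 : ((B.card : ℤ) - order P L + (A.card - order P L)) ^ 2 ≤ order P L := by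
    rwa [show (B.card : ℤ) - order P L + (A.card - order P L) = n by linarith]
  rcases le_total ((B.card : ℤ) - order P L) (A.card - order P L) with h4 | h4
  · have := small_nonprimal_half h (by linarith) h4 (by ring) (by ring) h3 hq5 hB
    omega
  · have := small_nonprimal_half (P := Dual L) (L := Dual P) h.dual
      (s := (A.card : ℤ) - order P L) (s' := (B.card : ℤ) - order P L) (by linarith) h4
      (by rw [Dual.order]; exact (by ring : (A.card : ℤ) = order P L + (A.card - order P L)))
      (by rw [Dual.order]; exact (by ring : (B.card : ℤ) = order P L + (B.card - order P L)))
      (by rw [Dual.order, add_comm]; exact h3) (by rw [Dual.order]; exact hq5)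
      (by intro x; rw [Dual.order]; exact hA x)
    rw [Dual.order] at this
    omega

/-- The six-plus-six configuration in order five has no point of degree four. -/
theorem ldeg_ne_four {A : Finset P} {B : Finset L} (h : Dom A B) (hq : order P L = 5)
    (hB : B.card = 6) (hA : A.card = 6) (x : P) : ldeg B x ≠ 4 := by
  intro hx
  -- A point of degree four forces `2 · 3 = 6 = |A|` uncovered points, so there is equality.
  have hU : unc P B = A := by
    refine eq_of_subset_of_card_le h.unc_subset ?_
    have := mul_le_card_unc B x
    rw [hx, hq, hB] at this
    push_cast at this
    rw [hA]; omega
  have hc1 := card_lns_sdiff B x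
  rw [hx, hq] at hc1
  have hc1' : (lns L x \ B).card = 2 := by push_cast at hc1; omega
  have hc2 : (B.filter (x ∉ ·)).card = 2 := by
    have := card_filter_add_card_filter_not (s := B) (p := (x ∈ ·))
    rw [ldeg_eq_card] at hx
    have hx' : (B.filter (x ∈ ·)).card = 4 := by exact_mod_cast hx
    omega
  obtain ⟨h1, h2, h12, hh⟩ := card_eq_two.1 hc1'
  obtain ⟨v1, v2, v12, hv⟩ := card_eq_two.1 hc2
  have hh1 : h1 ∈ lns L x \ B := by rw [hh]; simp
  have hh2 : h2 ∈ lns L x \ B := by rw [hh]; simp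
  have hv1 : v1 ∈ B.filter (x ∉ ·) := by rw [hv]; simp
  have hv2 : v2 ∈ B.filter (x ∉ ·) := by rw [hv]; simp
  simp only [mem_sdiff, mem_lns, mem_filter] at hh1 hh2 hv1 hv2
  have hAh : ∀ a ∈ A, a ∈ h1 ∨ a ∈ h2 := by
    intro a ha
    rw [← hU, mem_unc, ldeg_eq_zero_iff] at ha
    obtain ⟨m, hm1, hm2⟩ := exists_line_mem L x a
    have : m ∈ lns L x \ B := by
      simp only [mem_sdiff, mem_lns]
      exact ⟨hm1, fun hb => ha m hb hm2⟩
    rw [hh] at this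
    simp only [mem_insert, mem_singleton] at this
    rcases this with rfl | rfl
    · exact Or.inl hm2
    · exact Or.inr hm2
  obtain ⟨w, hwv1, hwv2⟩ := exists_point_mem P v1 v2
  -- All of `A` lies on the two lines through `x` outside `B`. The line joining `u1 ∩ g1` to `u2 ∩
  -- g2` is not in `B` and meets these two lines only in covered points, so nothing dominates it.
  have key : ∀ u1 u2 g1 g2 : L, u1 ∈ B → u2 ∈ B → x ∉ u1 → x ∉ u2 → g1 ∉ B → g2 ∉ B →
      x ∈ g1 → x ∈ g2 → g1 ≠ g2 → u1 ≠ u2 →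
      (∀ l ∈ B, x ∉ l → l = u1 ∨ l = u2) → (∀ a ∈ A, a ∈ g1 ∨ a ∈ g2) →
      w ∈ u1 → w ∈ u2 → w ∉ g1 → w ∉ g2 → False := by
    intro u1 u2 g1 g2 hu1 hu2 hxu1 hxu2 hg1 hg2 hxg1 hxg2 hg hu hBu hAg hw1 hw2 hwg1 hwg2
    obtain ⟨y, hy1, hy2⟩ := exists_point_mem P u1 g1
    obtain ⟨z, hz1, hz2⟩ := exists_point_mem P u2 g2
    obtain ⟨g, hyg, hzg⟩ := exists_line_mem L y z
    have hxy : x ≠ y := fun e => hxu1 (e ▸ hy1)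
    have hxz : x ≠ z := fun e => hxu2 (e ▸ hz1)
    have hyg2 : y ∉ g2 := fun e => hxy (eq_of_mem_mem hxg1 hy2 hxg2 e hg)
    have hzg1 : z ∉ g1 := fun e => hxz (eq_of_mem_mem hxg1 e hxg2 hz2 hg)
    have hyz : y ≠ z := fun e => hyg2 (e ▸ hz2)
    have hgg1 : g ≠ g1 := fun e => hzg1 (e ▸ hzg)
    have hgg2 : g ≠ g2 := fun e => hyg2 (e ▸ hyg)
    have hxg : x ∉ g := fun e => hgg1 (line_eq_of_mem_mem e hyg hxg1 hy2 hxy)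
    have hgB : g ∉ B := by
      intro hgB
      rcases hBu g hgB hxg with rfl | rfl
      · exact hwg2 ((eq_of_mem_mem hzg hw1 hz1 hw2 hu) ▸ hz2)
      · exact hwg1 ((eq_of_mem_mem hyg hw2 hy1 hw1 hu.symm) ▸ hy2)
    obtain ⟨a, ha, hag⟩ := h.2 g hgB
    have haU := ha
    rw [← hU, mem_unc, ldeg_eq_zero_iff] at haU
    rcases hAg a ha with h' | h'
    · exact haU u1 hu1 ((eq_of_mem_mem hyg hag hy2 h' hgg1) ▸ hy1)
    · exact haU u2 hu2 ((eq_of_mem_mem hzg hag hz2 h' hgg2) ▸ hz1)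
  have hBu : ∀ l ∈ B, x ∉ l → l = v1 ∨ l = v2 := by
    intro l hl hxl
    have : l ∈ B.filter (x ∉ ·) := by simp [hl, hxl]
    rw [hv] at this
    simpa using this
  have hwx : w ≠ x := fun e => hv1.2 (e ▸ hwv1)
  -- If `v1` and `v2` meet on one of the two lines, that line has at least four uncovered points and
  -- the other at least three: seven in total, but `|A| = 6`.
  by_cases hw : w ∈ h1 ∨ w ∈ h2
  · set g : P → ℤ := fun p => if ldeg B p = 0 then 1 else 0 with hg
    have hw2 : 2 ≤ ldeg B w := by
      rw [ldeg_eq_card]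
      have : ({v1, v2} : Finset L) ⊆ B.filter (w ∈ ·) := by
        intro l hl
        simp only [mem_insert, mem_singleton] at hl
        rcases hl with rfl | rfl
        · simp [hv1.1, hwv1]
        · simp [hv2.1, hwv2]
      have := card_le_card this
      rw [card_pair v12] at this
      exact_mod_cast this
    have hlow : ∀ m ∈ lns L x \ B, 3 + (if w ∈ m then 1 else 0) ≤ ∑ p ∈ pts P m, g p := by
      intro m hm
      simp only [mem_sdiff, mem_lns] at hm
      have e1 := sum_pts_sub_one (P := P) B hm.2
      rw [hB, hq] at e1
      have e2 : ∑ p ∈ pts P m, (if p = x then (3 : ℤ) else 0) = 3 := by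
        rw [sum_ite_eq', if_pos (by simpa using hm.1)]
      have e4 : ∑ p ∈ pts P m, (if p = w then (1 : ℤ) else 0) = if w ∈ m then 1 else 0 := by
        rw [sum_ite_eq']; simp
      have e3 : ∑ p ∈ pts P m, ((if p = x then 3 else 0) + (if p = w then 1 else 0) -
          (ldeg B p - 1)) ≤ ∑ p ∈ pts P m, g p := by
        refine sum_le_sum fun p _ => ?_
        have := ldeg_nonneg B p
        simp only [hg]
        by_cases hpx : p = x
        · rw [if_pos hpx, if_neg (fun e => hwx (e.symm.trans hpx)), hpx, hx]; norm_num
        · by_cases hpw : p = w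
          · rw [if_neg hpx, if_pos hpw, hpw, if_neg (by omega)]; omega
          · by_cases h0 : ldeg B p = 0
            · simp [hpx, hpw, h0]
            · simp only [hpx, hpw, h0, if_false]; omega
      rw [sum_sub_distrib, sum_add_distrib, e1, e2, e4] at e3
      push_cast at e3
      linarith
    have hup : ∑ m ∈ lns L x \ B, ∑ p ∈ pts P m, g p ≤ 6 := by
      have e1 := sum_lns_sum_pts (L := L) x g
      have e2 : g x = 0 := by simp [hg, hx]
      have e3 : ∑ p, g p = 6 := by
        simp only [hg]
        rw [sum_boole, ← unc, hU, hA]; rfl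
      rw [e2, e3, mul_zero, add_zero] at e1
      rw [← e1]
      exact sum_le_sum_of_subset_of_nonneg sdiff_subset
        (fun m _ _ => sum_nonneg fun p _ => by simp only [hg]; split_ifs <;> norm_num)
    have hsum := sum_le_sum hlow
    rw [hh, sum_pair h12, sum_pair h12] at hsum
    rw [hh, sum_pair h12] at hup
    rcases hw with hw | hw
    · rw [if_pos hw] at hsum
      split_ifs at hsum <;> linarith
    · rw [if_pos hw] at hsum
      split_ifs at hsum <;> linarith
  · push Not at hw
    exact key v1 v2 h1 h2 hv1.1 hv2.1 hv1.2 hv2.2 hh1.2 hh2.2 hh1.1 hh2.1 h12 v12 hBu hAh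
      hwv1 hwv2 hw.1 hw.2

/-- In the six-plus-six configuration every line of `B` has three points of degree one. -/
theorem three_le_card_ldeg_one {A : Finset P} {B : Finset L} (h : Dom A B) (hq : order P L = 5)
    (hB : B.card = 6) (hA : A.card = 6) (hnp : ∀ x : P, ldeg B x ≤ 4) :
    unc P B = A ∧ ∀ v ∈ B, 3 ≤ ((pts P v).filter (ldeg B · = 1)).card := by
  -- If all degrees were at most two, `quad_ineq` would read `25 ≤ 17`.
  obtain ⟨x, hx⟩ : ∃ x : P, 3 ≤ ldeg B x := by
    by_contra hx
    push Not at hx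
    have := quad_ineq h (s := 1) (s' := 1) (by norm_num) (by rw [hB, hq]; norm_num)
      (by rw [hA, hq]; norm_num) (fun x => by linarith [hx x])
    rw [hq] at this
    norm_num at this
  have h3 : ∀ y : P, ldeg B y ≤ 3 := fun y => by
    have h1 := hnp y
    have h2 := ldeg_ne_four h hq hB hA y
    omega
  have hU : unc P B = A := by
    refine eq_of_subset_of_card_le h.unc_subset ?_
    have := mul_le_card_unc B x
    rw [le_antisymm (h3 x) hx, hq, hB] at this
    push_cast at this
    rw [hA]; omega
  refine ⟨hU, ?_⟩
  have hU6 : (unc P B).card = 6 := by rw [hU, hA]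
  set r : L → ℤ := fun l => ∑ p ∈ pts P l, if ldeg B p = 3 then 1 else 0 with hr
  have hline : ∀ v ∈ B, ∑ p ∈ pts P v, (ldeg B p - 1) = 5 := by
    intro v hv
    rw [sum_sub_distrib, sum_pts_ldeg, if_pos hv, hB, hq]
    simp [card_pts, hq]
  have hpos : ∀ v ∈ B, ∀ p ∈ pts P v, 1 ≤ ldeg B p := fun v hv p hp =>
    one_le_ldeg_iff.2 ⟨v, hv, by simpa using hp⟩
  have hr2 : ∀ v ∈ B, r v ≤ 2 := by
    intro v hv
    have : ∑ p ∈ pts P v, (2 * if ldeg B p = 3 then (1 : ℤ) else 0) ≤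
        ∑ p ∈ pts P v, (ldeg B p - 1) := by
      refine sum_le_sum fun p hp => ?_
      have := hpos v hv p hp
      split_ifs <;> omega
    rw [← mul_sum, hline v hv] at this
    have : 2 * r v ≤ 5 := this
    omega
  -- The quadratic sum with `m = 2` equals `-8`, and a point of degree three contributes `-2` while
  -- degrees one and two contribute nothing. So there are four points of degree three.
  have htot : ∑ v ∈ B, r v = 12 := by
    simp only [hr]
    rw [sum_lines_sum_pts_int]
    have e1 := sum_quad_covered (P := P) B 2
    rw [hB, hq, hU6] at e1
    have e3 : ∀ p : P, 2 * (ldeg B p * (if ldeg B p = 3 then 1 else 0)) =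
        (-3) * (if ldeg B p = 0 then 0 else (ldeg B p - 1) * (2 - ldeg B p)) := by
      intro p
      have h1 := h3 p
      have h2 := ldeg_nonneg B p
      generalize ldeg B p = t at *
      interval_cases t <;> norm_num
    have e4 : 2 * ∑ p : P, (ldeg B p * (if ldeg B p = 3 then 1 else 0)) = 24 := by
      rw [mul_sum, sum_congr rfl (fun p _ => e3 p), ← mul_sum, e1]
      norm_num
    linarith
  -- Each of the six lines has at most two points of degree three, and the total is twelve. The
  -- line's excess of five then leaves one point of degree two and three of degree one.
  have hreq : ∀ v ∈ B, r v = 2 := by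
    have : ∑ v ∈ B, r v = ∑ v ∈ B, 2 := by rw [htot, sum_const, hB]; norm_num
    exact (sum_eq_sum_iff_of_le hr2).1 this
  intro v hv
  have e1 : ∑ p ∈ pts P v, ((ldeg B p - 1) - (if ldeg B p = 3 then 1 else 0)) =
      ∑ p ∈ pts P v, (1 - (if ldeg B p = 1 then 1 else 0)) := by
    refine sum_congr rfl fun p hp => ?_
    have h1 := h3 p
    have h2 := hpos v hv p hp
    generalize ldeg B p = t at *
    interval_cases t <;> norm_num
  rw [sum_sub_distrib (f := fun p => ldeg B p - 1), sum_sub_distrib (f := fun _ => (1 : ℤ)),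
    hline v hv] at e1
  have e2 : ∑ p ∈ pts P v, (if ldeg B p = 3 then (1 : ℤ) else 0) = 2 := hreq v hv
  rw [e2, sum_const, card_pts, hq, sum_boole] at e1
  norm_num at e1
  omega

/-- One step of a would-be instability is impossible in the six-plus-six configuration. -/
theorem six_six_exchange {A A₁ : Finset P} {B B₁ : Finset L} (h : Dom A B) (h₁ : Dom A₁ B₁)
    (hq : order P L = 5) (hB : B.card = 6) (hA : A.card = 6) (hnp : ∀ x : P, ldeg B x ≤ 4)
    {v : L} (hv : v ∈ B) (hv₁ : v ∉ B₁) (hAA : A ⊆ A₁) (hBB : B.erase v ⊆ B₁)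
    (hcard : A₁.card + B₁.card ≤ 13) : False := by
  obtain ⟨hU, h3⟩ := three_le_card_ldeg_one h hq hB hA hnp
  have h3 := h3 v hv
  set Z := (pts P v).filter (ldeg B · = 1) with hZ
  have hone : ∀ z ∈ Z, ∀ l ∈ B, z ∈ l → l = v := by
    intro z hz l hl hzl
    simp only [hZ, mem_filter, mem_pts] at hz
    have hc : (B.filter (z ∈ ·)).card = 1 := by
      have := hz.2; rw [ldeg_eq_card] at this; exact_mod_cast this
    exact card_le_one.1 hc.le l (by simp [hl, hzl]) v (by simp [hv, hz.1])
  have hzA : ∀ z ∈ Z, z ∉ A := by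
    intro z hz hzA
    rw [← hU, mem_unc] at hzA
    simp only [hZ, mem_filter] at hz
    omega
  -- Without `v`, each of its degree-one points needs a new dominating vertex. A line other than `v`
  -- meets `v` only once, so three new vertices are needed, and `6 + 5 + 3 > 13`.
  have hex : ∀ z ∈ Z, ∃ w : P ⊕ L, w ∈ (A₁ \ A).disjSum (B₁ \ B) ∧
      (w = Sum.inl z ∨ ∃ l, w = Sum.inr l ∧ z ∈ l) := by
    intro z hz
    by_cases hz1 : z ∈ A₁
    · exact ⟨Sum.inl z, by simp [hz1, hzA z hz], Or.inl rfl⟩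
    · obtain ⟨l, hl, hzl⟩ := h₁.1 z hz1
      refine ⟨Sum.inr l, ?_, Or.inr ⟨l, rfl, hzl⟩⟩
      simp only [inr_mem_disjSum, mem_sdiff]
      exact ⟨hl, fun hlB => hv₁ (hone z hz l hlB hzl ▸ hl)⟩
  have : Nonempty (P ⊕ L) := ⟨Sum.inr v⟩
  choose! f hf1 hf2 using hex
  have hle : Z.card ≤ ((A₁ \ A).disjSum (B₁ \ B)).card := by
    refine card_le_card_of_injOn f (fun z hz => hf1 z hz) ?_
    intro z hz z' hz' he
    rcases hf2 z hz with h1 | ⟨l, h1, hzl⟩ <;> rcases hf2 z' hz' with h2 | ⟨l', h2, hzl'⟩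
    · rw [h1, h2] at he; exact Sum.inl_injective he
    · rw [h1, h2] at he; cases he
    · rw [h1, h2] at he; cases he
    · rw [h1, h2] at he
      have hll := Sum.inr_injective he
      subst hll
      have hm := hf1 z hz
      rw [h1] at hm
      simp only [inr_mem_disjSum, mem_sdiff] at hm
      have hzv : z ∈ v := mem_pts.1 (mem_filter.1 (mem_coe.1 hz)).1
      have hzv' : z' ∈ v := mem_pts.1 (mem_filter.1 (mem_coe.1 hz')).1
      exact eq_of_mem_mem hzl hzl' hzv hzv' (fun e => hm.2 (e ▸ hv))
  rw [card_disjSum] at hle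
  have e1 := card_sdiff_add_card_eq_card hAA
  have e2 : (B₁ \ B).card + (B.erase v).card ≤ B₁.card := by
    rw [← card_union_of_disjoint]
    · exact card_le_card (union_subset sdiff_subset hBB)
    · exact disjoint_left.2 fun l hl hl' => (mem_sdiff.1 hl).2 (mem_of_mem_erase hl')
  rw [card_erase_of_mem hv] at e2
  omega

end SmallNonprimal

/-! ### Tight pairs: defects along lines, good lines and points of intermediate degree -/

section Concurrency

open Finset HasPoints HasLines Nondegenerate
open scoped Classical

variable {P L : Type*} [Membership P L] [Fintype P] [Fintype L]

/-- The defect of a point of degree at least two from the maximal degree `s + 1`. -/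
noncomputable def tau (B : Finset L) (s : ℤ) (p : P) : ℤ :=
  if 2 ≤ ldeg B p then s + 1 - ldeg B p else 0

/-- The excess of the degree of a covered point over one. -/
noncomputable def exc (B : Finset L) (p : P) : ℤ := if ldeg B p = 0 then 0 else ldeg B p - 1

/-- The product of excess and defect of a covered point. -/
noncomputable def phi (B : Finset L) (s : ℤ) (p : P) : ℤ :=
  if ldeg B p = 0 then 0 else (ldeg B p - 1) * (s + 1 - ldeg B p)

variable (P) in
/-- The number of points of degree at least two on a line. -/
noncomputable def zcard (B : Finset L) (l : L) : ℤ :=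
  ∑ p ∈ pts P l, if 2 ≤ ldeg B p then 1 else 0

variable (P) in
/-- The lines of `B` with at most `s + 1` points of degree at least two. -/
noncomputable def goodLines (B : Finset L) (s : ℤ) : Finset L := B.filter (zcard P B · ≤ s + 1)

/-- The numerical situation in which a non-primal dominating set could be too small. -/
structure TightPair [ProjectivePlane P L] (A : Finset P) (B : Finset L) (s d : ℤ) : Prop where
  dom : Dom A B
  nine_le : 9 ≤ s
  d_eq : d = 0 ∨ d = 1
  order_eq : (order P L : ℤ) = s ^ 2 + d
  card_lines : (B.card : ℤ) = order P L + s
  card_points : (A.card : ℤ) ≤ order P L + s + 1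
  ldeg_le : ∀ p : P, ldeg B p ≤ s + 1
  pdeg_le : ∀ l : L, pdeg A l ≤ s + 2

theorem tau_nonneg {B : Finset L} {s : ℤ} (h : ∀ p : P, ldeg B p ≤ s + 1) (p : P) :
    0 ≤ tau B s p := by
  have := h p
  unfold tau
  split_ifs <;> omega

theorem exc_nonneg (B : Finset L) (p : P) : 0 ≤ exc B p := by
  have := ldeg_nonneg B p
  unfold exc
  split_ifs <;> omega

theorem phi_nonneg {B : Finset L} {s : ℤ} (h : ∀ p : P, ldeg B p ≤ s + 1) (p : P) :
    0 ≤ phi B s p := by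
  have h1 := h p
  have h2 := ldeg_nonneg B p
  unfold phi
  split_ifs
  · exact le_rfl
  · exact mul_nonneg (by omega) (by omega)

/-- Turns the total defect along the lines of `B` into the quadratic sum, which `sum_phi` evaluates.
-/
theorem ldeg_mul_tau (B : Finset L) (s : ℤ) (p : P) :
    ldeg B p * tau B s p = phi B s p + tau B s p := by
  have h2 := ldeg_nonneg B p
  unfold phi tau
  split_ifs with h3 h4
  · omega
  · ring
  · rw [show ldeg B p = 0 by assumption]; ring
  · rw [show ldeg B p = 1 by omega]; ring

theorem tau_le_phi {B : Finset L} {s : ℤ} (h : ∀ p : P, ldeg B p ≤ s + 1) (p : P) :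
    tau B s p ≤ phi B s p := by
  have h1 := h p
  have h2 := ldeg_nonneg B p
  unfold phi tau
  split_ifs
  · omega
  · nlinarith
  · exact le_rfl
  · rw [show ldeg B p = 1 by omega]; simp

theorem two_le_ldeg_of_mem_mem {B : Finset L} {l m : L} {p : P} (hl : l ∈ B) (hm : m ∈ B)
    (hlm : l ≠ m) (hpl : p ∈ l) (hpm : p ∈ m) : 2 ≤ ldeg B p := by
  rw [ldeg_eq_card]
  have : ({l, m} : Finset L) ⊆ B.filter (p ∈ ·) := by
    intro k hk
    simp only [mem_insert, mem_singleton] at hk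
    rcases hk with rfl | rfl
    · simp [hl, hpl]
    · simp [hm, hpm]
  have := card_le_card this
  rw [card_pair hlm] at this
  exact_mod_cast this

theorem ldeg_pos_of_mem {B : Finset L} {l : L} {p : P} (hl : l ∈ B) (hp : p ∈ l) :
    1 ≤ ldeg B p := one_le_ldeg_iff.2 ⟨l, hl, hp⟩

variable [ProjectivePlane P L]

/-- The excesses on a line of `B` add up to `|B| - 1`, and a point of degree at least two has defect
`s` minus its excess. -/
theorem sum_line_tau {B : Finset L} (s : ℤ) {l : L} (hl : l ∈ B) :
    ∑ p ∈ pts P l, tau B s p = zcard P B l * s - (B.card - 1) := by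
  have e : ∑ p ∈ pts P l, tau B s p =
      ∑ p ∈ pts P l, ((if 2 ≤ ldeg B p then 1 else 0) * s - (ldeg B p - 1)) := by
    refine sum_congr rfl fun p hp => ?_
    have := ldeg_pos_of_mem hl (mem_pts.1 hp)
    unfold tau
    split_ifs
    · ring
    · rw [show ldeg B p = 1 by omega]; ring
  rw [e, sum_sub_distrib, ← sum_mul, sum_sub_distrib, sum_pts_ldeg, if_pos hl]
  simp only [zcard, sum_const, card_pts]
  simp only [nsmul_eq_mul, mul_one]
  push_cast
  ring

theorem sum_lines_tau (B : Finset L) (s : ℤ) :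
    ∑ l ∈ B, ∑ p ∈ pts P l, tau B s p = ∑ p : P, phi B s p + ∑ p : P, tau B s p := by
  rw [sum_lines_sum_pts_int, sum_congr rfl (fun p _ => ldeg_mul_tau B s p), sum_add_distrib]

theorem sum_line_exc (B : Finset L) {m : L} (hm : m ∉ B) :
    ∑ p ∈ pts P m, exc B p =
      B.card - (order P L + 1) + ∑ p ∈ pts P m, if ldeg B p = 0 then 1 else 0 := by
  rw [← sum_pts_sub_one (P := P) B hm, ← sum_add_distrib]
  refine sum_congr rfl fun p _ => ?_
  unfold exc
  split_ifs with h
  · rw [h]; ring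
  · ring

theorem Dom.sum_unc_le {A : Finset P} {B : Finset L} (h : Dom A B) (m : L) :
    ∑ p ∈ pts P m, (if ldeg B p = 0 then (1 : ℤ) else 0) ≤ pdeg A m := by
  rw [pdeg_eq_sum_pts]
  refine sum_le_sum fun p _ => ?_
  by_cases h0 : ldeg B p = 0
  · rw [if_pos h0, if_pos (h.unc_subset (by simpa using h0))]
  · rw [if_neg h0]; split_ifs <;> norm_num

theorem sum_phi (B : Finset L) (s : ℤ) (hB : (B.card : ℤ) = order P L + s) :
    ∑ p : P, phi B s p = (s + 1) * (unc P B).card -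
      ((order P L : ℤ) ^ 2 + order P L * (s - 1 - s ^ 2) - s + 1) := by
  have := sum_quad_covered (P := P) B (s + 1)
  rw [hB] at this
  simp only [phi, this]
  ring

theorem sum_exc (B : Finset L) :
    ∑ p : P, exc B p = B.card * (order P L + 1) - ((order P L : ℤ) ^ 2 + order P L + 1) +
      (unc P B).card := by
  have : ∀ p : P, exc B p = ldeg B p - 1 + if ldeg B p = 0 then 1 else 0 := by
    intro p
    unfold exc
    split_ifs with h
    · rw [h]; ring
    · ring
  rw [sum_congr rfl (fun p _ => this p), sum_add_distrib, sum_sub_distrib, sum_ldeg, sum_const,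
    nsmul_eq_mul, card_points_int P L, sum_boole, unc]
  ring

/-- The `B`-lines through a point `Y` cover every other point at most once. -/
theorem sum_filter_mem_le (B : Finset L) (Y : P) (f : P → ℤ) (hf : ∀ p, 0 ≤ f p) :
    ∑ l ∈ B.filter (Y ∈ ·), (∑ p ∈ pts P l, f p - f Y) ≤ ∑ p, f p - f Y := by
  set g : P → ℤ := fun p => if p = Y then 0 else f p with hg
  have hg0 : ∀ p, 0 ≤ g p := fun p => by simp only [hg]; split_ifs; exacts [le_rfl, hf p]
  have hfg : ∀ p, f p = g p + if p = Y then f p else 0 := fun p => by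
    simp only [hg]; split_ifs <;> ring
  have e1 : ∑ p, f p - f Y = ∑ p, g p := by
    rw [sum_congr rfl (fun p _ => hfg p), sum_add_distrib]; simp
  have e2 : ∀ l ∈ B.filter (Y ∈ ·), ∑ p ∈ pts P l, f p - f Y = ∑ p ∈ pts P l, g p := by
    intro l hl
    rw [sum_congr rfl (fun p _ => hfg p), sum_add_distrib, sum_ite_eq',
      if_pos (mem_pts.2 (mem_filter.1 hl).2)]
    ring
  have e3 := sum_lns_sum_pts (L := L) Y g
  rw [show g Y = 0 by simp [hg], mul_zero, add_zero] at e3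
  rw [e1, sum_congr rfl e2, ← e3]
  refine sum_le_sum_of_subset_of_nonneg (fun l hl => mem_lns.2 (mem_filter.1 hl).2)
    fun l _ _ => sum_nonneg fun p _ => hg0 p

namespace TightPair

variable {A : Finset P} {B : Finset L} {s d : ℤ}

/-- With only `s` points of degree at least two the total defect would be at most `1 - d - s < 0`.
-/
theorem zcard_ge (h : TightPair A B s d) {l : L} (hl : l ∈ B) : s + 1 ≤ zcard P B l := by
  have h1 := sum_line_tau (P := P) s hl
  have h2 : 0 ≤ ∑ p ∈ pts P l, tau B s p := sum_nonneg fun p _ => tau_nonneg h.ldeg_le p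
  rw [h1, h.card_lines, h.order_eq] at h2
  have h3 := h.nine_le
  have h4 := h.d_eq
  by_contra hlt
  have : zcard P B l ≤ s := by omega
  have h5 : 0 ≤ d := by omega
  nlinarith [mul_le_mul_of_nonneg_right this (by omega : 0 ≤ s)]

/-- So for `d = 1` the points of degree at least two on a good line all have degree `s + 1`; for `d
= 0` exactly one of them has degree `s`. -/
theorem sum_tau_good (h : TightPair A B s d) {l : L} (hl : l ∈ goodLines P B s) :
    ∑ p ∈ pts P l, tau B s p = 1 - d := by
  simp only [goodLines, mem_filter] at hl
  have h1 := sum_line_tau (P := P) s hl.1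
  have h2 := h.zcard_ge hl.1
  have h3 : zcard P B l = s + 1 := by omega
  rw [h1, h.card_lines, h.order_eq, h3]; ring

theorem sum_tau_bad (h : TightPair A B s d) {l : L} (hl : l ∈ B) (hl' : l ∉ goodLines P B s) :
    s + 1 - d ≤ ∑ p ∈ pts P l, tau B s p := by
  simp only [goodLines, mem_filter, not_and, not_le] at hl'
  have h1 := sum_line_tau (P := P) s hl
  have h2 := hl' hl
  rw [h1, h.card_lines, h.order_eq]
  nlinarith [h.nine_le]

theorem card_good_mul (h : TightPair A B s d) :
    B.card * (s + 1 - d) - (∑ p : P, phi B s p + ∑ p : P, tau B s p) ≤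
      (goodLines P B s).card * s := by
  have h1 : ∀ l ∈ B, s + 1 - d - (if l ∈ goodLines P B s then s else 0) ≤
      ∑ p ∈ pts P l, tau B s p := by
    intro l hl
    by_cases hg : l ∈ goodLines P B s
    · rw [if_pos hg, h.sum_tau_good hg]; linarith
    · rw [if_neg hg]; linarith [h.sum_tau_bad hl hg]
  have h2 := sum_le_sum h1
  rw [sum_lines_tau, sum_sub_distrib, sum_const, nsmul_eq_mul, sum_ite_mem, sum_const,
    nsmul_eq_mul] at h2
  have h3 : B ∩ goodLines P B s = goodLines P B s :=
    inter_eq_right.2 (filter_subset _ _)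
  rw [h3] at h2
  linarith

theorem card_unc_le (h : TightPair A B s d) : ((unc P B).card : ℤ) ≤ s ^ 2 + d + s + 1 := by
  have := h.dom.card_unc_le
  have := h.card_points
  rw [h.order_eq] at this
  linarith

theorem sum_phi_eq (h : TightPair A B s d) : ∑ p : P, phi B s p =
    (s + 1) * (unc P B).card - (s ^ 2 + d) * (d + s - 1) + s - 1 := by
  rw [sum_phi B s h.card_lines, h.order_eq]; ring

/-- A bad line has defect about `s`, while the total defect along lines is at most twice the sum of
`phi`, which is only quadratic in `s`. Hence only linearly many lines are bad. -/
theorem card_good_ge (h : TightPair A B s d) : s ^ 2 - 4 * s - 5 ≤ (goodLines P B s).card := by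
  have h1 := h.card_good_mul
  have h2 := h.sum_phi_eq
  have h3 : ∑ p : P, tau B s p ≤ ∑ p : P, phi B s p :=
    sum_le_sum fun p _ => tau_le_phi h.ldeg_le p
  have h4 := h.card_unc_le
  have h5 := h.nine_le
  rw [h.card_lines, h.order_eq] at h1
  have h6 : ∑ p : P, phi B s p ≤
      (s + 1) * (s ^ 2 + d + s + 1) - (s ^ 2 + d) * (d + s - 1) + s - 1 := by
    rw [h2]; nlinarith
  by_contra hlt
  push Not at hlt
  rcases h.d_eq with rfl | rfl
  · nlinarith
  · nlinarith

/-- On a good line, the points of degree at least two not joined to a point off the line. -/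
theorem card_not_joined (h : TightPair A B s d) {l : L} (hl : l ∈ goodLines P B s) {Y : P}
    (hY : Y ∉ l) :
    ∑ p ∈ pts P l, (if 2 ≤ ldeg B p ∧ ¬ Joined B Y p then (1 : ℤ) else 0) = s + 1 - ldeg B Y := by
  simp only [goodLines, mem_filter] at hl
  have h1 : zcard P B l = s + 1 := by
    have := h.zcard_ge hl.1; omega
  -- The lines of `B` through `Y` meet `l` in `ldeg B Y` points, all of degree at least two, and `l`
  -- has just `s + 1` such points.
  rw [← h1, ← card_joined B hY, zcard, card_filter]
  push_cast
  rw [← sum_sub_distrib]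
  refine sum_congr rfl fun p hp => ?_
  by_cases hj : Joined B Y p
  · obtain ⟨m, hm, hYm, hpm⟩ := hj
    have h2 : 2 ≤ ldeg B p :=
      two_le_ldeg_of_mem_mem hl.1 hm (fun e => hY (e ▸ hYm)) (mem_pts.1 hp) hpm
    have hj : Joined B Y p := ⟨m, hm, hYm, hpm⟩
    simp [h2, hj]
  · simp [hj]

/-- A point of maximal degree is joined to every point of degree at least two on a good line. -/
theorem joined_of_max (h : TightPair A B s d) {l : L} (hl : l ∈ goodLines P B s) {Q p : P}
    (hQ : ldeg B Q = s + 1) (hp : p ∈ l) (hp2 : 2 ≤ ldeg B p) : Joined B Q p := by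
  by_cases hQl : Q ∈ l
  · exact ⟨l, (mem_filter.1 hl).1, hQl, hp⟩
  · have h1 := h.card_not_joined hl hQl
    rw [hQ, sub_self, sum_eq_zero_iff_of_nonneg (fun p _ => by split_ifs <;> norm_num)] at h1
    have := h1 p (mem_pts.2 hp)
    by_contra hj
    simp [hp2, hj] at this

theorem tau_le_of_good (h : TightPair A B s d) {l : L} (hl : l ∈ goodLines P B s) {p : P}
    (hp : p ∈ l) : tau B s p ≤ 1 - d := by
  rw [← h.sum_tau_good hl]
  exact single_le_sum (f := tau B s) (fun p _ => tau_nonneg h.ldeg_le p) (mem_pts.2 hp)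

/-- Every point of intermediate degree belongs to `A`. -/
theorem mem_of_mid (h : TightPair A B s d) {Y : P} (h2 : 2 ≤ ldeg B Y) (hs : ldeg B Y ≤ s) :
    Y ∈ A := by
  by_contra hYA
  have h9 := h.nine_le
  have hd := h.d_eq
  -- Points on good lines that are not joined to `Y` receive weight. Counting it along the pencil of
  -- `Y` shows that it is small if `Y ∉ A`; counting it along the many good lines off `Y` shows that
  -- it is large.
  set e := ldeg B Y - 1 with he
  set Z : P → Prop := fun p =>
    2 ≤ ldeg B p ∧ ¬ Joined B Y p ∧ ∃ l ∈ goodLines P B s, p ∈ l with hZ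
  -- On `Z` this is `e` minus the defect, hence nonnegative: a point of a good line has defect at
  -- most `1 ≤ e`.
  set w : P → ℤ := fun p => if Z p then exc B p + e - s else 0 with hw
  have hYY : Joined B Y Y := by
    obtain ⟨l, hl, hYl⟩ := one_le_ldeg_iff.1 (by omega : 1 ≤ ldeg B Y)
    exact ⟨l, hl, hYl, hYl⟩
  have hexc : ∀ p, 2 ≤ ldeg B p → exc B p = s - tau B s p := by
    intro p hp
    unfold exc tau
    rw [if_neg (by omega), if_pos hp]; ring
  have hw0 : ∀ p, 0 ≤ w p := by
    intro p
    simp only [hw]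
    split_ifs with hp
    · obtain ⟨hp2, -, l, hl, hpl⟩ := hp
      have := h.tau_le_of_good hl hpl
      rw [hexc p hp2]; omega
    · exact le_rfl
  have hwY : w Y = 0 := by
    simp only [hw, hZ]
    rw [if_neg (fun hh => hh.2.1 hYY)]
  -- the weight on a line through `Y`
  have hlineB : ∀ m ∈ lns L Y, m ∈ B → ∑ p ∈ pts P m, w p = 0 := by
    intro m hm hmB
    refine sum_eq_zero fun p hp => ?_
    simp only [hw, hZ]
    rw [if_neg (fun hh => hh.2.1 ⟨m, hmB, mem_lns.1 hm, mem_pts.1 hp⟩)]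
  have hline : ∀ m ∈ lns L Y \ B, ∑ p ∈ pts P m, w p ≤ pdeg A m - 1 := by
    intro m hm
    simp only [mem_sdiff, mem_lns] at hm
    have hp1 : 1 ≤ pdeg A m := one_le_pdeg_iff.2 (h.dom.2 m hm.2)
    by_cases hex : ∃ z ∈ pts P m, Z z
    · obtain ⟨z, hzm, hz⟩ := hex
      have e1 := sum_line_exc (P := P) B hm.2
      have e2 := h.dom.sum_unc_le m
      rw [h.card_lines] at e1
      -- The point `Y` has excess `e` and `z` has excess `w z + (s - e)`, so together they use up
      -- `s` beyond the weight. The excess on `m` is `s - 1` plus the number of uncovered points.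
      have e3 : ∑ p ∈ pts P m, (w p + (if p = z then s - e else 0) + (if p = Y then e else 0)) ≤
          ∑ p ∈ pts P m, exc B p := by
        refine sum_le_sum fun p hp => ?_
        have h0 := exc_nonneg B p
        by_cases hpY : p = Y
        · have hpz : p ≠ z := fun e' => by
            rw [← e', hpY] at hz; exact hz.2.1 hYY
          rw [if_pos hpY, if_neg hpz, hpY, hwY]
          unfold exc; rw [if_neg (by omega)]; omega
        · rw [if_neg hpY]
          by_cases hpz : p = z
          · rw [if_pos hpz]
            simp only [hw]
            rw [if_pos (hpz ▸ hz)]; omega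
          · rw [if_neg hpz]
            simp only [hw]
            split_ifs <;> omega
      rw [sum_add_distrib, sum_add_distrib, sum_ite_eq', sum_ite_eq', if_pos hzm,
        if_pos (mem_pts.2 hm.1)] at e3
      linarith
    · have : ∑ p ∈ pts P m, w p = 0 := by
        refine sum_eq_zero fun p hp => ?_
        simp only [hw]
        rw [if_neg (fun hh => hex ⟨p, hp, hh⟩)]
      linarith
  -- Since `Y ∉ A`, the pencil of `Y` counts each point of `A` exactly once.
  have hsum : ∑ p, w p ≤ s + 1 + e := by
    have e1 := sum_lns_sum_pts (L := L) Y w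
    rw [hwY, mul_zero, add_zero] at e1
    have e2 : ∑ m ∈ lns L Y \ B, ∑ p ∈ pts P m, w p = ∑ m ∈ lns L Y, ∑ p ∈ pts P m, w p := by
      refine sum_subset sdiff_subset fun m hm hm' => hlineB m hm ?_
      by_contra hb
      exact hm' (mem_sdiff.2 ⟨hm, hb⟩)
    have e3 := sum_le_sum hline
    rw [sum_sub_distrib, sum_const, nsmul_eq_mul, mul_one, card_lns_sdiff] at e3
    have e4 : ∑ m ∈ lns L Y \ B, pdeg A m ≤ ∑ m ∈ lns L Y, pdeg A m :=
      sum_le_sum_of_subset_of_nonneg sdiff_subset fun m _ _ => pdeg_nonneg A m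
    rw [sum_lns_pdeg, if_neg hYA] at e4
    have e5 := h.card_points
    linarith
  -- the weight on the good lines off `Y`
  have hgood : ∀ l ∈ (goodLines P B s).filter (Y ∉ ·),
      (s - e) * e - (1 - d) ≤ ∑ p ∈ pts P l, w p := by
    intro l hl
    simp only [mem_filter] at hl
    have e1 := h.card_not_joined hl.1 hl.2
    have e2 : ∑ p ∈ pts P l, ((if 2 ≤ ldeg B p ∧ ¬ Joined B Y p then (1 : ℤ) else 0) * e -
        tau B s p) ≤ ∑ p ∈ pts P l, w p := by
      refine sum_le_sum fun p hp => ?_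
      have h0 := tau_nonneg h.ldeg_le p
      by_cases hpz : 2 ≤ ldeg B p ∧ ¬ Joined B Y p
      · simp only [hw]
        rw [if_pos hpz, if_pos ⟨hpz.1, hpz.2, l, hl.1, mem_pts.1 hp⟩, hexc p hpz.1]
        linarith
      · rw [if_neg hpz]
        linarith [hw0 p]
    rw [sum_sub_distrib, ← sum_mul, e1, h.sum_tau_good hl.1] at e2
    linarith
  have htot : ∑ l ∈ (goodLines P B s).filter (Y ∉ ·), ∑ p ∈ pts P l, w p ≤
      (s + 1) * ∑ p, w p := by
    have e1 : ∑ l ∈ (goodLines P B s).filter (Y ∉ ·), ∑ p ∈ pts P l, w p ≤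
        ∑ l ∈ B, ∑ p ∈ pts P l, w p :=
      sum_le_sum_of_subset_of_nonneg ((filter_subset _ _).trans (filter_subset _ _))
        fun l _ _ => sum_nonneg fun p _ => hw0 p
    refine e1.trans ?_
    rw [sum_lines_sum_pts_int, mul_sum]
    exact sum_le_sum fun p _ => mul_le_mul_of_nonneg_right (h.ldeg_le p) (hw0 p)
  have hcard : s ^ 2 - 5 * s - 5 ≤ ((goodLines P B s).filter (Y ∉ ·)).card := by
    have e1 := card_filter_add_card_filter_not (s := goodLines P B s) (p := (Y ∈ ·))
    have e2 : (((goodLines P B s).filter (Y ∈ ·)).card : ℤ) ≤ ldeg B Y := by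
      rw [ldeg_eq_card]
      exact_mod_cast card_le_card (filter_subset_filter _ (filter_subset _ _))
    have e3 := h.card_good_ge
    have e4 : (((goodLines P B s).filter (Y ∈ ·)).card : ℤ) +
      ((goodLines P B s).filter (Y ∉ ·)).card = (goodLines P B s).card := by exact_mod_cast e1
    linarith
  have hfin := (sum_le_sum hgood).trans htot
  rw [sum_const, nsmul_eq_mul] at hfin
  have he1 : 1 ≤ e := by omega
  have he2 : e ≤ s - 1 := by omega
  have hk : s - 2 ≤ (s - e) * e - (1 - d) := by
    have : s - 1 ≤ (s - e) * e := by nlinarith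
    omega
  -- This is where `s ≥ 9`, hence order at least `81`, matters: at `s = 9` it reads `217 ≤ 180`, but
  -- at `s = 8` it reads `114 ≤ 144`.
  have h10 : (s ^ 2 - 5 * s - 5) * (s - 2) ≤ (s + 1) * (2 * s) := by
    calc (s ^ 2 - 5 * s - 5) * (s - 2)
        ≤ ((goodLines P B s).filter (Y ∉ ·)).card * (s - 2) :=
          mul_le_mul_of_nonneg_right hcard (by omega)
      _ ≤ ((goodLines P B s).filter (Y ∉ ·)).card * ((s - e) * e - (1 - d)) :=
          mul_le_mul_of_nonneg_left hk (by positivity)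
      _ ≤ (s + 1) * ∑ p, w p := hfin
      _ ≤ (s + 1) * (2 * s) := mul_le_mul_of_nonneg_left (by linarith) (by omega)
  have h11 : 0 ≤ s - 9 := by omega
  nlinarith [mul_nonneg h11 h11, mul_nonneg (mul_nonneg h11 h11) h11]

end TightPair

end Concurrency

/-! ### Tight pairs do not exist -/

section TightContradiction

open Finset HasPoints HasLines Nondegenerate
open scoped Classical

variable {P L : Type*} [Membership P L] [Fintype P] [Fintype L]

/-- The indicator function of the points of degree `s + 1`. -/
noncomputable def maxInd (B : Finset L) (s : ℤ) (p : P) : ℤ := if ldeg B p = s + 1 then 1 else 0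

/-- The indicator function of the points of degree between `2` and `s`. -/
noncomputable def midInd (B : Finset L) (s : ℤ) (p : P) : ℤ :=
  if 2 ≤ ldeg B p ∧ ldeg B p ≤ s then 1 else 0

/-- The excess, restricted to points of degree between `2` and `s`. -/
noncomputable def midExc (B : Finset L) (s : ℤ) (p : P) : ℤ :=
  if 2 ≤ ldeg B p ∧ ldeg B p ≤ s then ldeg B p - 1 else 0

/-- The indicator function of the points of degree between `2` and `s` on a good line. -/
noncomputable def goodMidInd (B : Finset L) (s : ℤ) (p : P) : ℤ :=
  if (2 ≤ ldeg B p ∧ ldeg B p ≤ s) ∧ ∃ l ∈ goodLines P B s, p ∈ l then 1 else 0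

theorem goodMidInd_nonneg (B : Finset L) (s : ℤ) (p : P) : 0 ≤ goodMidInd B s p := by
  unfold goodMidInd; split_ifs <;> norm_num

theorem goodMidInd_of_mid {B : Finset L} {s : ℤ} {p : P} (h : 2 ≤ ldeg B p ∧ ldeg B p ≤ s)
    (hg : ∃ l ∈ goodLines P B s, p ∈ l) : goodMidInd B s p = 1 := if_pos ⟨h, hg⟩

theorem goodMidInd_of_not_mid {B : Finset L} {s : ℤ} {p : P}
    (h : ¬ (2 ≤ ldeg B p ∧ ldeg B p ≤ s)) : goodMidInd B s p = 0 := if_neg fun hh => h hh.1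

theorem goodMidInd_of_not_good {B : Finset L} {s : ℤ} {p : P}
    (h : ¬ ∃ l ∈ goodLines P B s, p ∈ l) : goodMidInd B s p = 0 := if_neg fun hh => h hh.2

variable [ProjectivePlane P L]

theorem eq_of_joined_of_notMem {B : Finset L} {m : L} (hm : m ∉ B) {p r : P} (hp : p ∈ m)
    (hr : r ∈ m) (h : Joined B p r) : p = r := by
  obtain ⟨l, hl, hpl, hrl⟩ := h
  by_contra hne
  exact hm (line_eq_of_mem_mem hpl hrl hp hr hne ▸ hl)

/-- Weights bounded by `c` on each line through an uncovered point. -/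
theorem sum_le_of_uncovered {B : Finset L} {X : P} (hX : ldeg B X = 0) (v : P → ℤ) (c : ℤ)
    (hv : v X = 0) (h : ∀ m ∉ B, X ∈ m → ∑ p ∈ pts P m, v p ≤ c) :
    ∑ p, v p ≤ (order P L + 1) * c := by
  have e1 := sum_lns_sum_pts (L := L) X v
  rw [hv, mul_zero, add_zero] at e1
  rw [← e1]
  have : ∀ m ∈ lns L X, ∑ p ∈ pts P m, v p ≤ c := fun m hm =>
    h m (fun hb => ldeg_eq_zero_iff.1 hX m hb (mem_lns.1 hm)) (mem_lns.1 hm)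
  refine (sum_le_sum this).trans ?_
  rw [sum_const, nsmul_eq_mul, card_lns]
  push_cast
  exact le_rfl

/-- An indicator sum over a line is at most one if the line has at most one such point. -/
theorem sum_ind_le_one {α : Type*} (S : Finset α) (p : α → Prop) [DecidablePred p]
    (h : ∀ a ∈ S, ∀ b ∈ S, p a → p b → a = b) :
    ∑ a ∈ S, (if p a then (1 : ℤ) else 0) ≤ 1 := by
  rw [sum_boole]
  have : (S.filter p).card ≤ 1 := card_le_one.2 fun a ha b hb => by
    simp only [mem_filter] at ha hb
    exact h a ha.1 b hb.1 ha.2 hb.2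
  exact_mod_cast this

namespace TightPair

variable {A : Finset P} {B : Finset L} {s d : ℤ}

theorem exc_eq (h : TightPair A B s d) (p : P) : exc B p = s * maxInd B s p + midExc B s p := by
  have h1 := h.ldeg_le p
  have h2 := ldeg_nonneg B p
  have h3 := h.nine_le
  unfold exc maxInd midExc
  by_cases h0 : ldeg B p = s + 1
  · rw [if_neg (by omega), if_pos h0, if_neg (by omega)]; linarith
  · rw [if_neg h0]; split_ifs <;> omega

theorem tau_eq (h : TightPair A B s d) (p : P) : tau B s p = s * midInd B s p - midExc B s p := by
  have h1 := h.ldeg_le p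
  have h3 := h.nine_le
  unfold tau midInd midExc
  by_cases hp : 2 ≤ ldeg B p ∧ ldeg B p ≤ s
  · rw [if_pos hp.1, if_pos hp, if_pos hp]; ring
  · rw [if_neg hp, if_neg hp]; split_ifs <;> omega

theorem midInd_le_phi (h : TightPair A B s d) (p : P) : (s - 1) * midInd B s p ≤ phi B s p := by
  have h1 := phi_nonneg h.ldeg_le p
  unfold midInd
  split_ifs with h2
  · unfold phi
    rw [if_neg (by omega)]
    nlinarith [mul_nonneg (sub_nonneg.2 h2.1) (sub_nonneg.2 h2.2)]
  · linarith

theorem midExc_le_phi (h : TightPair A B s d) (p : P) : midExc B s p ≤ phi B s p := by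
  have h1 := phi_nonneg h.ldeg_le p
  unfold midExc
  split_ifs with h2
  · unfold phi
    rw [if_neg (by omega)]
    nlinarith
  · linarith

theorem sum_exc_eq (h : TightPair A B s d) : s * ∑ p : P, maxInd B s p + ∑ p : P, midExc B s p =
    s * (s ^ 2 + d) + s - 1 + (unc P B).card := by
  rw [mul_sum, ← sum_add_distrib, ← sum_congr rfl (fun p _ => h.exc_eq p), sum_exc, h.card_lines,
    h.order_eq]
  ring

theorem sum_tau_eq (h : TightPair A B s d) :
    ∑ p : P, tau B s p = s * ∑ p : P, midInd B s p - ∑ p : P, midExc B s p := by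
  rw [mul_sum, ← sum_sub_distrib]
  exact sum_congr rfl fun p _ => h.tau_eq p

/-- The gain from `mem_of_mid`: points of intermediate degree compete with the uncovered points for
room in `A`. -/
theorem card_unc_add_mid_le (h : TightPair A B s d) :
    (unc P B).card + ∑ p : P, midInd B s p ≤ s ^ 2 + d + s + 1 := by
  have e1 : ((unc P B).card : ℤ) + ∑ p : P, midInd B s p ≤ A.card := by
    simp only [midInd]
    rw [sum_boole]
    norm_cast
    rw [← card_union_of_disjoint]
    · refine card_le_card (union_subset h.dom.unc_subset fun p hp => ?_)
      simp only [mem_filter] at hp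
      exact h.mem_of_mid hp.2.1 hp.2.2
    · refine disjoint_left.2 fun p hp hp' => ?_
      simp only [mem_filter, mem_unc] at hp hp'
      omega
  have := h.card_points
  rw [h.order_eq] at this
  linarith

/-- Otherwise the sum of `phi` would be negative. All lines through such a point are outside `B`, as
`sum_le_of_uncovered` requires. -/
theorem exists_uncovered (h : TightPair A B s d) : ∃ X : P, ldeg B X = 0 := by
  have h1 : 0 ≤ ∑ p : P, phi B s p := sum_nonneg fun p _ => phi_nonneg h.ldeg_le p
  rw [h.sum_phi_eq] at h1
  have h9 := h.nine_le
  by_contra hX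
  have : unc P B = ∅ := by
    rw [eq_empty_iff_forall_notMem]
    intro p hp
    exact hX ⟨p, mem_unc.1 hp⟩
  rw [this] at h1
  simp only [card_empty, Nat.cast_zero, mul_zero] at h1
  rcases h.d_eq with rfl | rfl <;> nlinarith [mul_nonneg (sub_nonneg.2 h9) (sub_nonneg.2 h9)]

/-- A point of degree at least two all of whose `B`-lines are bad forces a large total defect. -/
theorem sum_tau_ge_of_bad (h : TightPair A B s d) {Y : P} (h2 : 2 ≤ ldeg B Y)
    (hbad : ∀ l ∈ goodLines P B s, Y ∉ l) :
    ldeg B Y * (ldeg B Y - d) + (s + 1 - ldeg B Y) ≤ ∑ p : P, tau B s p := by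
  have hY : tau B s Y = s + 1 - ldeg B Y := by unfold tau; rw [if_pos h2]
  have h1 := sum_filter_mem_le B Y (tau B s) (tau_nonneg h.ldeg_le)
  -- A bad line has defect at least `s + 1 - d`, of which `s + 1 - ldeg B Y` sits at `Y`.
  have h3 : ∀ l ∈ B.filter (Y ∈ ·), ldeg B Y - d ≤ ∑ p ∈ pts P l, tau B s p - tau B s Y := by
    intro l hl
    simp only [mem_filter] at hl
    have := h.sum_tau_bad hl.1 (fun hg => hbad l hg hl.2)
    linarith
  have h4 := (sum_le_sum h3).trans h1
  rw [sum_const, nsmul_eq_mul, ← ldeg_eq_card] at h4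
  linarith

/-- The total defect `T` is too small for a point of degree `s + 1` to have only bad lines. So any
two points of maximal degree are joined, and the pencil of an uncovered point shows that there are
at most `q + 1` of them. The remaining excess `E` is then at least `s² - 1`, which pushes `T` down
to `s + 1`. Points of intermediate degree have only bad lines, so now their degree is two, and `E`
is at most their number `μ ≤ s + 1`. -/
theorem false_of_one (h : TightPair A B s 1) : False := by
  have h9 := h.nine_le
  have hS := h.sum_phi_eq
  have hU := h.card_unc_add_mid_le
  have hT := h.sum_tau_eq
  have hE := h.sum_exc_eq
  set U : ℤ := ((unc P B).card : ℤ)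
  set μ := ∑ p : P, midInd B s p with hμ
  set E := ∑ p : P, midExc B s p with hEd
  set N := ∑ p : P, maxInd B s p with hN
  set T := ∑ p : P, tau B s p with hTd
  set S := ∑ p : P, phi B s p with hSd
  have hμS : (s - 1) * μ ≤ S := by
    rw [hμ, mul_sum]; exact sum_le_sum fun p _ => h.midInd_le_phi p
  have hES : E ≤ S := sum_le_sum fun p _ => h.midExc_le_phi p
  have hμ1 : μ ≤ s + 1 := by
    by_contra hlt
    push Not at hlt
    nlinarith
  have hTμ : T ≤ (s - 1) * μ := by
    have : μ ≤ E := by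
      rw [hμ, hEd]
      refine sum_le_sum fun p _ => ?_
      unfold midInd midExc
      split_ifs <;> omega
    linarith
  have hgood : ∀ Q : P, ldeg B Q = s + 1 → ∃ l ∈ goodLines P B s, Q ∈ l := by
    intro Q hQ
    by_contra hne
    push Not at hne
    have := h.sum_tau_ge_of_bad (by omega) hne
    rw [hQ] at this
    nlinarith
  have hNq : N ≤ s ^ 2 + 2 := by
    obtain ⟨X, hX⟩ := h.exists_uncovered
    have := sum_le_of_uncovered hX (maxInd B s) 1
      (by unfold maxInd; rw [hX, if_neg (by omega)]) (by
        intro m hm _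
        unfold maxInd
        refine sum_ind_le_one _ _ fun a ha b hb hta htb => ?_
        obtain ⟨l, hl, hbl⟩ := hgood b htb
        exact eq_of_joined_of_notMem hm (mem_pts.1 ha) (mem_pts.1 hb)
          (h.joined_of_max hl hta hbl (by omega)))
    rw [h.order_eq] at this
    linarith
  have hEU : U - 1 ≤ E := by nlinarith
  have hU2 : s ^ 2 ≤ U := by
    by_contra hlt
    push Not at hlt
    nlinarith
  have hT1 : T ≤ s + 1 := by nlinarith
  have hmid : ∀ p : P, midExc B s p ≤ midInd B s p := by
    intro p
    unfold midExc midInd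
    split_ifs with hp
    · have h1 := h.sum_tau_ge_of_bad hp.1 (fun l hl hpl => by
        have := h.tau_le_of_good hl hpl
        unfold tau at this
        rw [if_pos hp.1] at this
        omega)
      nlinarith
    · exact le_rfl
  have hEμ : E ≤ μ := by
    rw [hEd, hμ]; exact sum_le_sum fun p _ => hmid p
  nlinarith

theorem mid_unique (h : TightPair A B s 0) {l : L} (hl : l ∈ goodLines P B s) {p r : P}
    (hp : p ∈ l) (hr : r ∈ l) (hp1 : 1 ≤ tau B s p) (hr1 : 1 ≤ tau B s r) : p = r := by
  by_contra hne
  have h1 := h.sum_tau_good hl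
  have h2 : ∑ z ∈ {p, r}, tau B s z ≤ ∑ z ∈ pts P l, tau B s z := by
    refine sum_le_sum_of_subset_of_nonneg ?_ fun z _ _ => tau_nonneg h.ldeg_le z
    intro z hz
    simp only [mem_insert, mem_singleton] at hz
    rcases hz with rfl | rfl
    · exact mem_pts.2 hp
    · exact mem_pts.2 hr
  rw [sum_pair hne, h1] at h2
  omega

theorem one_le_tau {p : P} (h2 : 2 ≤ ldeg B p) (hs : ldeg B p ≤ s) : 1 ≤ tau B s p := by
  unfold tau
  rw [if_pos h2]; omega

/-- `R'` has degree `s`, or at least is not maximal, so some point of degree at least two on `l` is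
not joined to it. Points of maximal degree are joined to `R'` because it lies on a good line, so the
unjoined point is `R`, the only intermediate point of `l`. -/
theorem mid_not_joined (h : TightPair A B s 0) {l l' : L} (hl : l ∈ goodLines P B s)
    (hl' : l' ∈ goodLines P B s) {R R' : P} (hR : R ∈ l) (hR' : R' ∈ l') (hne : R ≠ R')
    (h1 : 2 ≤ ldeg B R) (h2 : ldeg B R ≤ s) (h1' : 2 ≤ ldeg B R') (h2' : ldeg B R' ≤ s) :
    ¬ Joined B R' R := by
  intro hj
  have hR'l : R' ∉ l := fun hR'l =>
    hne (h.mid_unique hl hR hR'l (one_le_tau h1 h2) (one_le_tau h1' h2'))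
  have e1 := h.card_not_joined hl hR'l
  rw [sum_eq_zero] at e1
  · omega
  · intro p hp
    rw [if_neg]
    rintro ⟨hp2, hpj⟩
    by_cases hps : ldeg B p ≤ s
    · exact hpj (h.mid_unique hl (mem_pts.1 hp) hR (one_le_tau hp2 hps) (one_le_tau h1 h2) ▸ hj)
    · have hpm : ldeg B p = s + 1 := le_antisymm (h.ldeg_le p) (by omega)
      exact hpj (h.joined_of_max hl' hpm hR' h1').symm

theorem ldeg_of_good_mid (h : TightPair A B s 0) {p : P} (hp : 2 ≤ ldeg B p ∧ ldeg B p ≤ s)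
    (hg : ∃ l ∈ goodLines P B s, p ∈ l) : ldeg B p = s := by
  obtain ⟨l, hl, hpl⟩ := hg
  have := h.tau_le_of_good hl hpl
  unfold tau at this
  rw [if_pos hp.1] at this
  omega

theorem sum_goodMidInd_le_one (h : TightPair A B s 0) {l : L} (hl : l ∈ B) :
    ∑ p ∈ pts P l, goodMidInd B s p ≤ 1 := by
  unfold goodMidInd
  refine sum_ind_le_one _ _ fun a ha b hb hra hrb => ?_
  obtain ⟨⟨ha1, ha2⟩, m, hm, ham⟩ := hra
  obtain ⟨⟨hb1, hb2⟩, m', hm', hbm⟩ := hrb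
  by_contra hne
  exact h.mid_not_joined hm hm' ham hbm hne ha1 ha2 hb1 hb2 ⟨l, hl, mem_pts.1 hb, mem_pts.1 ha⟩

theorem one_le_sum_goodMidInd (h : TightPair A B s 0) {l : L} (hl : l ∈ goodLines P B s) :
    1 ≤ ∑ p ∈ pts P l, goodMidInd B s p := by
  have e1 := h.sum_tau_good hl
  obtain ⟨p, hp, hp0⟩ : ∃ p ∈ pts P l, tau B s p ≠ 0 := by
    by_contra hne
    push Not at hne
    rw [sum_eq_zero hne] at e1
    norm_num at e1
  have hrp : goodMidInd B s p = 1 := by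
    unfold tau at hp0
    have := h.ldeg_le p
    split_ifs at hp0 with h2
    · exact goodMidInd_of_mid ⟨h2, by omega⟩ ⟨l, hl, mem_pts.1 hp⟩
    · exact absurd rfl hp0
  rw [← hrp]
  exact single_le_sum (f := goodMidInd B s) (fun p _ => goodMidInd_nonneg B s p) hp

theorem sum_lines_goodMidInd (h : TightPair A B s 0) :
    ∑ l ∈ B, ∑ p ∈ pts P l, goodMidInd B s p = s * ∑ p : P, goodMidInd B s p := by
  rw [sum_lines_sum_pts_int, mul_sum]
  refine sum_congr rfl fun p _ => ?_
  by_cases hp : 2 ≤ ldeg B p ∧ ldeg B p ≤ s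
  · by_cases hg : ∃ l ∈ goodLines P B s, p ∈ l
    · rw [h.ldeg_of_good_mid hp hg]
    · rw [goodMidInd_of_not_good hg]; simp
  · rw [goodMidInd_of_not_mid hp]; simp

/-- A point of maximal degree is joined to all the others that are counted, so it is alone on `m`.
Without it, three points of degree `s` would have excess `3(s - 1)`, more than the `2s + 1` allowed
by `pdeg_le`. -/
theorem line_weight_le_two (h : TightPair A B s 0)
    (hgood : ∀ Q : P, ldeg B Q = s + 1 → ∃ l ∈ goodLines P B s, Q ∈ l) {m : L} (hm : m ∉ B) :
    ∑ p ∈ pts P m, (2 * maxInd B s p + goodMidInd B s p) ≤ 2 := by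
  have h9 := h.nine_le
  rw [sum_add_distrib, ← mul_sum]
  have hj : ∀ a ∈ pts P m, ∀ b ∈ pts P m, ldeg B a = s + 1 → 2 ≤ ldeg B b →
      (∃ l ∈ goodLines P B s, b ∈ l) → a = b := by
    rintro a ha b hb hta htb ⟨l, hl, hbl⟩
    exact eq_of_joined_of_notMem hm (mem_pts.1 ha) (mem_pts.1 hb) (h.joined_of_max hl hta hbl htb)
  have e1 : ∑ p ∈ pts P m, maxInd B s p ≤ 1 := by
    unfold maxInd
    exact sum_ind_le_one _ _ fun a ha b hb hta htb =>
      hj a ha b hb hta (by omega) (hgood b htb)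
  by_cases hex : ∃ Q ∈ pts P m, ldeg B Q = s + 1
  · obtain ⟨Q, hQm, hQ⟩ := hex
    have e2 : ∑ p ∈ pts P m, goodMidInd B s p = 0 := by
      refine sum_eq_zero fun p hp => if_neg ?_
      rintro ⟨⟨hp1, hp2⟩, hp3⟩
      have := hj Q hQm p hp hQ hp1 hp3
      rw [← this] at hp2
      omega
    rw [e2]; linarith
  · have e2 : ∑ p ∈ pts P m, maxInd B s p = 0 :=
      sum_eq_zero fun p hp => if_neg (fun hh => hex ⟨p, hp, hh⟩)
    have e3 : ∑ p ∈ pts P m, (s - 1) * goodMidInd B s p ≤ ∑ p ∈ pts P m, exc B p := by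
      refine sum_le_sum fun p _ => ?_
      have h0 := exc_nonneg B p
      by_cases hp : 2 ≤ ldeg B p ∧ ldeg B p ≤ s
      · by_cases hg : ∃ l ∈ goodLines P B s, p ∈ l
        · have := h.ldeg_of_good_mid hp hg
          rw [goodMidInd_of_mid hp hg]
          unfold exc
          rw [if_neg (by omega)]; linarith
        · rw [goodMidInd_of_not_good hg]; linarith
      · rw [goodMidInd_of_not_mid hp]; linarith
    rw [← mul_sum, sum_line_exc B hm, h.card_lines] at e3
    have e4 := h.dom.sum_unc_le m
    have e5 := h.pdeg_le m
    rw [e2]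
    by_contra hlt
    have h3 : 3 ≤ ∑ p ∈ pts P m, goodMidInd B s p := by omega
    have h4 : (s - 1) * 3 ≤ (s - 1) * ∑ p ∈ pts P m, goodMidInd B s p :=
      mul_le_mul_of_nonneg_left h3 (by omega)
    linarith

/-- Each good line has exactly one intermediate point; let `ρ` count such points. They are pairwise
unjoined and have degree `s`, so `ρ ≤ s + 1`, while the number of good lines gives `ρ ≥ s`. The
weighted count `2N + ρ ≤ 2(q + 1)` forces a large excess on intermediate points and a total defect
`T` linear in `s`. Intermediate points off all good lines then have low degree, so their excess,
quadratic in `s` in total, is at most their defect, which is linear. -/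
theorem false_of_zero (h : TightPair A B s 0) : False := by
  have h9 := h.nine_le
  have hs0 : 0 ≤ s := by omega
  have hss : 9 * s ≤ s ^ 2 := by nlinarith
  have hS := h.sum_phi_eq
  have hU := h.card_unc_add_mid_le
  have hT := h.sum_tau_eq
  have hE := h.sum_exc_eq
  have hG := h.card_good_mul
  rw [h.card_lines, h.order_eq] at hG
  set U : ℤ := ((unc P B).card : ℤ)
  set μ := ∑ p : P, midInd B s p with hμ
  set E := ∑ p : P, midExc B s p with hEd
  set N := ∑ p : P, maxInd B s p with hN
  set T := ∑ p : P, tau B s p with hTd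
  set S := ∑ p : P, phi B s p with hSd
  set ρ := ∑ p : P, goodMidInd B s p with hρ
  have hρ1 : ρ ≤ s + 1 := by
    have e1 := sum_le_sum fun l (hl : l ∈ B) => h.sum_goodMidInd_le_one hl
    rw [h.sum_lines_goodMidInd, sum_const, nsmul_eq_mul, mul_one, h.card_lines, h.order_eq] at e1
    exact le_of_mul_le_mul_left (by linarith : s * ρ ≤ s * (s + 1)) (by omega)
  have hGρ : ((goodLines P B s).card : ℤ) ≤ s * ρ := by
    have e1 := sum_le_sum fun l (hl : l ∈ goodLines P B s) => h.one_le_sum_goodMidInd hl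
    rw [sum_const, nsmul_eq_mul, mul_one] at e1
    rw [hρ, ← h.sum_lines_goodMidInd]
    exact e1.trans (sum_le_sum_of_subset_of_nonneg (filter_subset _ _)
      fun l _ _ => sum_nonneg fun p _ => goodMidInd_nonneg B s p)
  have hμS : (s - 1) * μ ≤ S := by
    rw [hμ, mul_sum]; exact sum_le_sum fun p _ => h.midInd_le_phi p
  have hES : E ≤ S := sum_le_sum fun p _ => h.midExc_le_phi p
  have hρμ : ρ ≤ μ := by
    rw [hρ, hμ]
    refine sum_le_sum fun p _ => ?_
    unfold goodMidInd midInd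
    split_ifs with h1 h2 <;> first | (exact absurd h1.1 h2) | norm_num
  have hTρ : T ≤ ρ + (s - 1) * (μ - ρ) := by
    have : ∑ p : P, tau B s p ≤
        ∑ p : P, (goodMidInd B s p + (s - 1) * (midInd B s p - goodMidInd B s p)) := by
      refine sum_le_sum fun p _ => ?_
      have hp1 := h.ldeg_le p
      by_cases hp : 2 ≤ ldeg B p ∧ ldeg B p ≤ s
      · unfold tau midInd
        rw [if_pos hp.1, if_pos hp]
        by_cases hg : ∃ l ∈ goodLines P B s, p ∈ l
        · rw [goodMidInd_of_mid hp hg, h.ldeg_of_good_mid hp hg]; linarith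
        · rw [goodMidInd_of_not_good hg]; linarith
      · rw [goodMidInd_of_not_mid hp]
        unfold tau midInd
        rw [if_neg hp]
        split_ifs <;> omega
    rw [sum_add_distrib, ← mul_sum, sum_sub_distrib] at this
    exact this
  have hSU : S ≤ 3 * s ^ 2 + 3 * s - (s + 1) * μ := by
    rw [hS]; linarith [mul_le_mul_of_nonneg_left hU (by omega : 0 ≤ s + 1)]
  -- Each counted point lies on only `s` lines of `B`, so fewer than `s` of them could not serve all
  -- the good lines provided by `card_good_mul`.
  have hρs : s ≤ ρ := by
    by_contra hlt
    have hlt' : ρ ≤ s - 1 := by omega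
    have e1 : (goodLines P B s).card * s ≤ s * ρ * s :=
      mul_le_mul_of_nonneg_right hGρ (by omega)
    have e2 : s ^ 3 - s ^ 2 - 2 * s ≤ (s ^ 2 - s) * ρ := by linarith
    have e3 : (s ^ 2 - s) * ρ ≤ (s ^ 2 - s) * (s - 1) :=
      mul_le_mul_of_nonneg_left hlt' (by linarith)
    linarith
  have hμ2 : 2 * μ ≤ 3 * s + 3 :=
    le_of_mul_le_mul_left (by linarith : s * (2 * μ) ≤ s * (3 * s + 3)) (by omega)
  have hgood : ∀ Q : P, ldeg B Q = s + 1 → ∃ l ∈ goodLines P B s, Q ∈ l := by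
    intro Q hQ
    by_contra hne
    push Not at hne
    have := h.sum_tau_ge_of_bad (by omega) hne
    rw [hQ] at this
    have h1 : (s - 1) * (2 * (μ - ρ)) ≤ (s - 1) * (s + 3) :=
      mul_le_mul_of_nonneg_left (by linarith) (by omega)
    linarith
  have hN2 : 2 * N + ρ ≤ 2 * s ^ 2 + 2 := by
    obtain ⟨X, hX⟩ := h.exists_uncovered
    have := sum_le_of_uncovered hX (fun p => 2 * maxInd B s p + goodMidInd B s p) 2
      (by
        unfold maxInd
        rw [goodMidInd_of_not_mid (by omega), if_neg (by omega)]; norm_num)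
      (fun m hm _ => h.line_weight_le_two hgood hm)
    rw [h.order_eq, sum_add_distrib, ← mul_sum] at this
    linarith
  have hE2 : 2 * U - 2 + s * ρ ≤ 2 * E := by
    linarith [mul_le_mul_of_nonneg_left hN2 hs0]
  have hU2 : 2 * s ^ 2 - 2 * s - 2 + ρ ≤ 2 * U := by
    have : s * (2 * s ^ 2 - 2 * s - 2 + ρ) ≤ s * (2 * U) := by linarith
    exact le_of_mul_le_mul_left this (by omega)
  have hT2 : 2 * T ≤ 5 * s + 4 := by
    have e1 : 2 * T ≤ 2 * s ^ 2 + 6 * s + 4 - (2 * s + 1) * ρ := by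
      have e2 : s * μ ≤ s * (s ^ 2 + s + 1 - U) :=
        mul_le_mul_of_nonneg_left (by linarith) (by omega)
      have e3 : (s + 1) * (2 * s ^ 2 - 2 * s - 2 + ρ) ≤ (s + 1) * (2 * U) :=
        mul_le_mul_of_nonneg_left hU2 (by omega)
      linarith
    linarith [mul_le_mul_of_nonneg_left hρs (by omega : 0 ≤ 2 * s + 1)]
  have hEo : s ^ 2 - 1 ≤ 2 * (E - (s - 1) * ρ) := by
    have : (s - 3) * ρ ≤ (s - 3) * (s + 1) := mul_le_mul_of_nonneg_left hρ1 (by omega)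
    linarith
  have hfin : E - (s - 1) * ρ ≤ T - ρ := by
    have : ∑ p : P, (midExc B s p - (s - 1) * goodMidInd B s p) ≤
        ∑ p : P, (tau B s p - goodMidInd B s p) := by
      refine sum_le_sum fun p _ => ?_
      by_cases hp : 2 ≤ ldeg B p ∧ ldeg B p ≤ s
      · unfold tau midExc
        rw [if_pos hp.1, if_pos hp]
        by_cases hg : ∃ l ∈ goodLines P B s, p ∈ l
        · rw [goodMidInd_of_mid hp hg, h.ldeg_of_good_mid hp hg]; linarith
        · rw [goodMidInd_of_not_good hg]
          -- With `2T ≤ 5s + 4` this gives `2 * ldeg B p ≤ s + 2`, that is, excess at most defect.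
          have e1 := h.sum_tau_ge_of_bad hp.1 (fun l hl hpl => hg ⟨l, hl, hpl⟩)
          have e2 : 2 * ((ldeg B p) * (ldeg B p - 0) + (s + 1 - ldeg B p)) ≤ 5 * s + 4 := by
            linarith
          clear_value U μ E N T S ρ
          clear * - e2 h9 hp
          by_contra hlt
          have : s + 3 ≤ 2 * ldeg B p := by omega
          nlinarith
      · have := tau_nonneg h.ldeg_le p
        unfold midExc
        rw [goodMidInd_of_not_mid hp, if_neg hp]
        linarith
    rw [sum_sub_distrib, sum_sub_distrib, ← mul_sum] at this
    exact this
  linarith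

end TightPair

end TightContradiction

/-! ### The lower bound for non-primal sets -/

section LargeOrder

open Finset HasPoints HasLines Nondegenerate
open scoped Classical

variable {P L : Type*} [Membership P L] [Fintype P] [Fintype L] [ProjectivePlane P L]

/-- Here `|B| - 1 > s(s + 1)`, so every line of `B` has at least `s + 2` points of degree at least
two and defect at least `s - 2`. The total is cubic in `s`, but the sum of `phi` is only quadratic.
-/
theorem order_sub_sq_ne {A : Finset P} {B : Finset L} (h : Dom A B) {s d : ℤ} (hs : 9 ≤ s)
    (hq : (order P L : ℤ) = s ^ 2 + d) (hB : (B.card : ℤ) = order P L + s)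
    (hA : (A.card : ℤ) ≤ order P L + s + 1) (hdeg : ∀ p : P, ldeg B p ≤ s + 1)
    (hd2 : 2 ≤ d) (hd3 : d ≤ 3) : False := by
  have h1 : ∀ l ∈ B, s - 2 ≤ ∑ p ∈ pts P l, tau B s p := by
    intro l hl
    have e1 := sum_line_tau (P := P) s hl
    have e2 : 0 ≤ ∑ p ∈ pts P l, tau B s p := sum_nonneg fun p _ => tau_nonneg hdeg p
    rw [hB, hq] at e1
    have e3 : s + 2 ≤ zcard P B l := by
      by_contra hlt
      have : zcard P B l ≤ s + 1 := by omega
      have := mul_le_mul_of_nonneg_right this (by omega : 0 ≤ s)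
      linarith
    have := mul_le_mul_of_nonneg_right e3 (by omega : 0 ≤ s)
    linarith
  have h2 := sum_le_sum h1
  rw [sum_lines_tau, sum_const, nsmul_eq_mul, hB, hq] at h2
  have h3 : ∑ p : P, tau B s p ≤ ∑ p : P, phi B s p :=
    sum_le_sum fun p _ => tau_le_phi hdeg p
  have h4 := sum_phi (P := P) B s hB
  have h5 := h.card_unc_le
  rw [hq] at h4 hA
  have h6 : (s + 1) * ((unc P B).card : ℤ) ≤ (s + 1) * (s ^ 2 + d + s + 1) :=
    mul_le_mul_of_nonneg_left (by linarith) (by omega)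
  have h7 : 9 * s ≤ s ^ 2 := by nlinarith
  have h8 : 9 * s ^ 2 ≤ s ^ 3 := by nlinarith
  have h9 : d = 2 ∨ d = 3 := by omega
  rcases h9 with rfl | rfl <;> linarith

/-- Since `s ≤ s'`, the size bound gives `s ≤ σ`. Then `quad_ineq` excludes `s < σ` as well as `q ≥
s² + 4`, leaving four values of `q - s²`. -/
theorem nonprimal_half_false {A : Finset P} {B : Finset L} (h : Dom A B) {s s' σ : ℤ}
    (hs : 0 ≤ s) (hss : s ≤ s') (hσ : 9 ≤ σ) (hσ1 : σ ^ 2 ≤ order P L)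
    (hσ2 : (order P L : ℤ) < (σ + 1) ^ 2) (hB : (B.card : ℤ) = order P L + s)
    (hA : (A.card : ℤ) = order P L + s') (hsum : s + s' ≤ 2 * σ + 1)
    (hldeg : ∀ x : P, ldeg B x ≤ order P L - 1) (hpdeg : ∀ l : L, pdeg A l ≤ order P L - 1) :
    False := by
  have hσ9 : 9 * σ ≤ σ ^ 2 := by nlinarith
  have hdeg : ∀ x : P, ldeg B x ≤ s + 1 := fun x =>
    h.ldeg_le hB hA (by linarith) (hldeg x)
  have hquad := quad_ineq h hs hB hA hdeg
  have hprod : 4 * ((s + 1) * s') ≤ (2 * σ + 2) ^ 2 := by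
    nlinarith [sq_nonneg (s + 1 - s')]
  have hsσ : s = σ := by
    by_contra hne
    have hlt : s ≤ σ - 1 := by omega
    have e1 : s ^ 2 ≤ (σ - 1) ^ 2 := by nlinarith
    have e2 : s ^ 2 * order P L ≤ (σ - 1) ^ 2 * order P L :=
      mul_le_mul_of_nonneg_right e1 (by positivity)
    have e3 : σ ^ 2 * order P L ≤ (order P L : ℤ) * order P L :=
      mul_le_mul_of_nonneg_right hσ1 (by positivity)
    have e4 : 15 * (order P L : ℤ) ≤ (2 * σ - 3) * order P L :=
      mul_le_mul_of_nonneg_right (by linarith) (by positivity)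
    linarith
  subst hsσ
  obtain ⟨d, hd⟩ : ∃ d : ℤ, (order P L : ℤ) = s ^ 2 + d := ⟨order P L - s ^ 2, by ring⟩
  have hd0 : 0 ≤ d := by linarith
  have hd3 : d ≤ 3 := by
    by_contra hlt
    have h4 : 4 ≤ d := by omega
    have e1 : 4 * (order P L : ℤ) ≤ d * order P L :=
      mul_le_mul_of_nonneg_right h4 (by positivity)
    have e2 : (order P L : ℤ) ^ 2 = s ^ 2 * order P L + d * order P L := by
      rw [sq]; nth_rewrite 1 [hd]; ring
    linarith
  by_cases hd2 : 2 ≤ d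
  · exact order_sub_sq_ne h hσ hd hB (by linarith) hdeg hd2 hd3
  · have hpd : ∀ l : L, pdeg A l ≤ s + 2 := by
      intro l
      have := h.dual.ldeg_le (s := s') (s' := s) (x := (l : Dual L)) (by rw [Dual.order]; exact hA)
        (by rw [Dual.order]; exact hB) (by rw [Dual.order]; linarith)
        (by rw [Dual.order]; exact hpdeg l)
      exact this.trans (by linarith)
    have ht : TightPair A B s d := ⟨h, hσ, by omega, hd, hB, by linarith, hdeg, hpd⟩
    obtain rfl | rfl : d = 0 ∨ d = 1 := by omega
    · exact ht.false_of_zero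
    · exact ht.false_of_one

/-- Non-primal dominating sets in planes of order at least `81` have at least
`2q + 2⌊√q⌋ + 2` elements. -/
theorem nonprimal_card_ge {A : Finset P} {B : Finset L} (h : Dom A B) (hq : 81 ≤ order P L)
    (hldeg : ∀ x : P, ldeg B x ≤ order P L - 1) (hpdeg : ∀ l : L, pdeg A l ≤ order P L - 1) :
    2 * order P L + 2 * Nat.sqrt (order P L) + 2 ≤ A.card + B.card := by
  by_contra hlt
  set σ : ℕ := Nat.sqrt (order P L) with hσd
  have hσ9 : 9 ≤ σ := Nat.le_sqrt.2 (by omega)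
  have hσ1 : σ ^ 2 ≤ order P L := Nat.sqrt_le' _
  have hσ2 : order P L < (σ + 1) ^ 2 := Nat.lt_succ_sqrt' _
  have hσ1' : (σ : ℤ) ^ 2 ≤ order P L := by exact_mod_cast hσ1
  have hσ2' : (order P L : ℤ) < ((σ : ℤ) + 1) ^ 2 := by exact_mod_cast hσ2
  have hσ9' : (9 : ℤ) ≤ σ := by exact_mod_cast hσ9
  have hlt' : (A.card : ℤ) + B.card ≤ 2 * order P L + 2 * σ + 1 := by
    have : A.card + B.card ≤ 2 * order P L + 2 * σ + 1 := by omega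
    exact_mod_cast this
  have h3 : (A.card + B.card : ℤ) < 3 * order P L - 1 := by nlinarith
  have h1 := h.lines_ge h3
  have h2 := h.points_ge h3
  rcases le_total ((B.card : ℤ) - order P L) (A.card - order P L) with h4 | h4
  · exact nonprimal_half_false h (by linarith) h4 hσ9' hσ1' hσ2' (by ring) (by ring)
      (by linarith) hldeg hpdeg
  · exact nonprimal_half_false (P := Dual L) (L := Dual P) h.dual
      (s := (A.card : ℤ) - order P L) (s' := (B.card : ℤ) - order P L) (σ := σ)
      (by linarith) h4 hσ9' (by rw [Dual.order]; exact hσ1') (by rw [Dual.order]; exact hσ2')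
      (by rw [Dual.order]; exact (by ring : (A.card : ℤ) = order P L + (A.card - order P L)))
      (by rw [Dual.order]; exact (by ring : (B.card : ℤ) = order P L + (B.card - order P L)))
      (by linarith) (by rw [Dual.order]; exact hpdeg) (by rw [Dual.order]; exact hldeg)

end LargeOrder

/-! ### Sets containing most of a pencil, and Bruen's inequality with skew lines -/

section Pencil

open Finset HasPoints HasLines Nondegenerate
open scoped Classical

variable {P L : Type*} [Membership P L] [Fintype P] [Fintype L]

/-- The vertex set consisting of the points `A` and the lines `B` is a minimal dominating set. -/
def MinDom (A : Finset P) (B : Finset L) : Prop :=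
  Dom A B ∧ ∀ A' ⊆ A, ∀ B' ⊆ B, Dom A' B' → A' = A ∧ B' = B

theorem MinDom.dual {A : Finset P} {B : Finset L} (h : MinDom A B) :
    MinDom (P := Dual L) (L := Dual P) B A :=
  ⟨h.1.dual, fun B' hB A' hA hD => (h.2 A' hA B' hB ⟨hD.2, hD.1⟩).symm⟩

variable [ProjectivePlane P L]

theorem dom_of_pencil {A : Finset P} {B : Finset L} {x : P} (hx : lns L x ⊆ B)
    (h : ∀ l, l ∉ B → ∃ p ∈ A, p ∈ l) : Dom A B := by
  refine ⟨fun p _ => ?_, h⟩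
  obtain ⟨l, hxl, hpl⟩ := exists_line_mem L x p
  exact ⟨l, hx (mem_lns.2 hxl), hpl⟩

theorem dom_pts_lns (x : P) (l : L) : Dom (pts P l) (lns L x) := by
  refine dom_of_pencil Subset.rfl fun m _ => ?_
  obtain ⟨p, h1, h2⟩ := exists_point_mem P l m
  exact ⟨p, mem_pts.2 h1, h2⟩

theorem dom_pts_lns_erase {x : P} {l : L} (h : x ∈ l) :
    Dom ((pts P l).erase x) ((lns L x).erase l) := by
  constructor
  · intro p hp
    obtain ⟨m, hxm, hpm⟩ := exists_line_mem L x p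
    by_cases hpl : p ∈ l
    · have hpx : p = x := by
        by_contra hne
        exact hp (mem_erase.2 ⟨hne, mem_pts.2 hpl⟩)
      subst hpx
      have : ((lns L p).erase l).Nonempty := by
        rw [← card_pos, card_erase_of_mem (mem_lns.2 h), card_lns]
        have := one_lt_order P L
        omega
      obtain ⟨k, hk⟩ := this
      exact ⟨k, hk, mem_lns.1 (mem_of_mem_erase hk)⟩
    · exact ⟨m, mem_erase.2 ⟨fun e => hpl (e ▸ hpm), mem_lns.2 hxm⟩, hpm⟩
  · intro m hm
    obtain ⟨p, hpl, hpm⟩ := exists_point_mem P l m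
    by_cases hml : m = l
    · subst hml
      have : ((pts P m).erase x).Nonempty := by
        rw [← card_pos, card_erase_of_mem (mem_pts.2 h), card_pts]
        have := one_lt_order P L
        omega
      obtain ⟨k, hk⟩ := this
      exact ⟨k, hk, mem_pts.1 (mem_of_mem_erase hk)⟩
    · refine ⟨p, mem_erase.2 ⟨fun e => hm ?_, mem_pts.2 hpl⟩, hpm⟩
      exact mem_erase.2 ⟨hml, mem_lns.2 (e ▸ hpm)⟩

/-- If exactly one line of a pencil is missing then its other points are all present, or the
dominating set is large. -/
theorem Dom.pts_subset_or_large {A : Finset P} {B : Finset L} (h : Dom A B) {x : P} {l : L}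
    (hxl : x ∈ l) (hl : l ∉ B) (hx : ldeg B x = order P L) :
    (pts P l).erase x ⊆ A ∨ 3 * (order P L : ℤ) - 1 ≤ A.card + B.card := by
  by_cases hsub : (pts P l).erase x ⊆ A
  · exact Or.inl hsub
  right
  obtain ⟨Q, hQ, hQA⟩ := not_subset.1 hsub
  simp only [mem_erase, mem_pts] at hQ
  -- This bounds `|B|` and `h2` bounds `|A|`; the terms `pdeg A l` and `ldeg B Q` cancel in the sum,
  -- which is `3q - 1`.
  have h1 : ∑ p ∈ pts P l, ((1 - if p ∈ A then 1 else 0) + (if p = x then (order P L : ℤ) - 1 else 0)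
      + (if p = Q then ldeg B Q - 1 else 0)) ≤ ∑ p ∈ pts P l, ldeg B p := by
    refine sum_le_sum fun p hp => ?_
    by_cases hpx : p = x
    · have hne : p ≠ Q := fun e => hQ.1 (e.symm.trans hpx)
      rw [if_pos hpx, if_neg hne, hpx, hx]
      split_ifs <;> omega
    · rw [if_neg hpx]
      by_cases hpQ : p = Q
      · rw [if_pos hpQ, hpQ, if_neg hQA]; omega
      · rw [if_neg hpQ]
        by_cases hpA : p ∈ A
        · rw [if_pos hpA]
          linarith [ldeg_nonneg B p]
        · rw [if_neg hpA]
          have := one_le_ldeg_iff.2 (h.1 p hpA)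
          linarith
  rw [sum_pts_ldeg, if_neg hl, sum_add_distrib, sum_add_distrib, sum_sub_distrib,
    ← pdeg_eq_sum_pts, sum_ite_eq', sum_ite_eq', if_pos (mem_pts.2 hxl), if_pos (mem_pts.2 hQ.2),
    sum_const, card_pts, nsmul_eq_mul] at h1
  have h2 : ∑ m ∈ lns L Q \ B, (1 + if m = l then pdeg A l - 1 else 0) ≤
      ∑ m ∈ lns L Q, pdeg A m := by
    refine le_trans (sum_le_sum fun m hm => ?_)
      (sum_le_sum_of_subset_of_nonneg sdiff_subset fun m _ _ => pdeg_nonneg A m)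
    by_cases hml : m = l
    · rw [if_pos hml, hml]; linarith
    · rw [if_neg hml]
      simp only [mem_sdiff] at hm
      linarith [one_le_pdeg_iff.2 (h.2 m hm.2)]
  rw [sum_lns_pdeg, if_neg hQA, sum_add_distrib, sum_ite_eq',
    if_pos (mem_sdiff.2 ⟨mem_lns.2 hQ.2, hl⟩), sum_const, nsmul_eq_mul, card_lns_sdiff] at h2
  push_cast at h1
  linarith

variable (L) in
/-- The lines skew to a set of points. -/
noncomputable def skew (C : Finset P) : Finset L := univ.filter (pdeg C · = 0)

@[simp] theorem mem_skew {C : Finset P} {l : L} : l ∈ skew L C ↔ pdeg C l = 0 := by simp [skew]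

/-- A line meeting `C`, but not contained in it, has at most `|C| - q` points of `C`. -/
theorem pdeg_le_of_small {C : Finset P} (hC : (C.card : ℤ) + (skew L C).card < 2 * order P L)
    {l : L} (hl : l ∉ skew L C) (hfull : ¬ pts P l ⊆ C) :
    pdeg C l ≤ C.card - order P L := by
  have key : ∀ Q ∈ pts P l, Q ∉ C →
      pdeg C l + order P L - ldeg (skew L C) Q ≤ C.card := by
    intro Q hQl hQ
    have h2 : ∑ m ∈ lns L Q \ skew L C, (1 + if m = l then pdeg C l - 1 else 0) ≤
        ∑ m ∈ lns L Q, pdeg C m := by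
      refine le_trans (sum_le_sum fun m hm => ?_)
        (sum_le_sum_of_subset_of_nonneg sdiff_subset fun m _ _ => pdeg_nonneg C m)
      by_cases hml : m = l
      · rw [if_pos hml, hml]; linarith
      · rw [if_neg hml]
        simp only [mem_sdiff, mem_skew] at hm
        have := pdeg_nonneg C m
        omega
    rw [sum_lns_pdeg, if_neg hQ, sum_add_distrib, sum_ite_eq',
      if_pos (mem_sdiff.2 ⟨mem_lns.2 (mem_pts.1 hQl), hl⟩), sum_const, nsmul_eq_mul,
      card_lns_sdiff] at h2
    linarith
  -- Through such a `Q` all `q` other lines meet `C`. If there is none, every point of `l` outside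
  -- `C` is on a skew line, and these are so many that `|C|` and their number add up to at least
  -- `2q`.
  by_cases hex : ∃ Q ∈ pts P l, Q ∉ C ∧ ldeg (skew L C) Q = 0
  · obtain ⟨Q, hQl, hQ, hQ0⟩ := hex
    have := key Q hQl hQ
    linarith
  · exfalso
    push Not at hex
    obtain ⟨Q, hQl, hQ⟩ := not_subset.1 hfull
    have h1 : ∑ p ∈ pts P l, ((1 - if p ∈ C then 1 else 0) +
        (if p = Q then ldeg (skew L C) Q - 1 else 0)) ≤ ∑ p ∈ pts P l, ldeg (skew L C) p := by
      refine sum_le_sum fun p hp => ?_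
      have h0 := ldeg_nonneg (skew L C) p
      by_cases hpQ : p = Q
      · rw [if_pos hpQ, hpQ, if_neg hQ]; omega
      · rw [if_neg hpQ]
        by_cases hpC : p ∈ C
        · rw [if_pos hpC]; linarith
        · rw [if_neg hpC]
          have := hex p hp hpC
          omega
    rw [sum_pts_ldeg, if_neg hl, sum_add_distrib, sum_sub_distrib, ← pdeg_eq_sum_pts, sum_ite_eq',
      if_pos hQl, sum_const, card_pts, nsmul_eq_mul] at h1
    have := key Q hQl hQ
    push_cast at h1
    linarith

/-- The choice `m = |C| - q` is the secant bound of `pdeg_le_of_small`, so all terms are nonnegative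
there. Without skew lines this is Bruen's bound. -/
theorem sum_quad_skew (C : Finset P) (m : ℤ) (hC : (C.card : ℤ) = order P L + m) :
    ∑ l : L, (if pdeg C l = 0 then 0 else (pdeg C l - 1) * (m - pdeg C l)) =
      m * (skew L C).card - order P L * (order P L - (m - 1) ^ 2) := by
  have h := sum_quad_covered (P := Dual L) (L := Dual P) C m
  rw [Dual.order] at h
  have h' : ∑ l : L, (if pdeg C l = 0 then 0 else (pdeg C l - 1) * (m - pdeg C l)) =
      m * (skew L C).card - C.card * (C.card + order P L) +
        (m + 1) * (C.card * (order P L + 1)) -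
        m * ((order P L : ℤ) ^ 2 + order P L + 1) := h
  rw [h', hC]
  ring

/-- Bruen's inequality, in a version for sets of points with few skew lines. -/
theorem bruen_skew {C : Finset P} (hC : (C.card : ℤ) + (skew L C).card < 2 * order P L)
    (hfull : ∀ l : L, ¬ pts P l ⊆ C) {m : ℤ} (hm : (C.card : ℤ) = order P L + m) :
    order P L * (order P L - (m - 1) ^ 2) ≤ m * (skew L C).card := by
  have h := sum_quad_skew (L := L) C m hm
  have h2 : 0 ≤ ∑ l : L, (if pdeg C l = 0 then 0 else (pdeg C l - 1) * (m - pdeg C l)) := by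
    refine sum_nonneg fun l _ => ?_
    split_ifs with h0
    · exact le_rfl
    · have h1 := pdeg_le_of_small hC (l := l) (by simpa using h0) (hfull l)
      have := pdeg_nonneg C l
      exact mul_nonneg (by omega) (by linarith)
  linarith

/-- In the case of equality in Bruen's theorem all line intersections have size `1` or `m`. -/
theorem bruen_eq {C : Finset P} (hC : (C.card : ℤ) < 2 * order P L) (hsk : skew L C = ∅)
    (hfull : ∀ l : L, ¬ pts P l ⊆ C) {m : ℤ} (hm : (C.card : ℤ) = order P L + m)
    (hq : (order P L : ℤ) = (m - 1) ^ 2) (l : L) : pdeg C l = 1 ∨ pdeg C l = m := by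
  have hC' : (C.card : ℤ) + (skew L C).card < 2 * order P L := by rw [hsk]; simpa using hC
  have h := sum_quad_skew (L := L) C m hm
  rw [hsk, ← hq] at h
  simp only [card_empty, Nat.cast_zero, mul_zero, sub_self] at h
  have hns : ∀ l : L, pdeg C l ≠ 0 := fun l h0 => by
    have : l ∈ skew L C := by simpa using h0
    rw [hsk] at this
    simp at this
  rw [sum_eq_zero_iff_of_nonneg] at h
  · have := h l (mem_univ l)
    rw [if_neg (hns l)] at this
    rcases mul_eq_zero.1 this with h1 | h1 <;> omega
  · intro l _
    rw [if_neg (hns l)]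
    have h1 := pdeg_le_of_small hC' (l := l) (by rw [hsk]; simp) (hfull l)
    have h2 := pdeg_nonneg C l
    have h3 := hns l
    exact mul_nonneg (by omega) (by linarith)

end Pencil

/-! ### Recognising Baer subplanes -/

section Baer

open Finset HasPoints HasLines Nondegenerate
open scoped Classical

variable {P L : Type*} [Membership P L] [Fintype P] [Fintype L] [ProjectivePlane P L]

/-- A set of points with all line intersections of size `1` or `m` is a Baer subplane. -/
theorem isBaerSubplane_of_pdeg {C : Finset P} {m : ℕ} (hm : 3 ≤ m)
    (hC : (C.card : ℤ) = order P L + m) (hq : (order P L : ℤ) = ((m : ℤ) - 1) ^ 2)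
    (hl : ∀ l : L, pdeg C l = 1 ∨ pdeg C l = m) : IsBaerSubplane L (C : Set P) := by
  have hpos : ∀ l : L, 1 ≤ pdeg C l := fun l => by rcases hl l with h | h <;> omega
  set T : Set L := {l | pdeg C l = m} with hT
  have hline : ∀ p ∈ C, ∀ r ∈ C, p ≠ r → ∀ l : L, p ∈ l → r ∈ l → l ∈ T := by
    intro p hp r hr hne l hpl hrl
    have h2 : 2 ≤ pdeg C l := by
      rw [pdeg_eq_card]
      have : ({p, r} : Finset P) ⊆ C.filter (· ∈ l) := by
        intro z hz
        simp only [mem_insert, mem_singleton] at hz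
        rcases hz with rfl | rfl
        · simp [hp, hpl]
        · simp [hr, hrl]
      have := card_le_card this
      rw [card_pair hne] at this
      exact_mod_cast this
    rcases hl l with h | h
    · omega
    · exact h
  -- The lines through a point outside `C` partition `C`; two `m`-secants among them would give `2m
  -- + (q - 1) > q + m` points.
  have hpoint : ∀ l ∈ T, ∀ k ∈ T, l ≠ k → ∀ p : P, p ∈ l → p ∈ k → p ∈ C := by
    intro l hlT k hkT hne p hpl hpk
    by_contra hp
    have h1 := sum_lns_pdeg (L := L) C p
    rw [if_neg hp, hC] at h1
    have h2 : ∑ n ∈ lns L p, (1 + (if n = l then (m : ℤ) - 1 else 0) +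
        (if n = k then (m : ℤ) - 1 else 0)) ≤ ∑ n ∈ lns L p, pdeg C n := by
      refine sum_le_sum fun n _ => ?_
      by_cases hnl : n = l
      · have : n ≠ k := fun e => hne (hnl.symm.trans e)
        rw [if_pos hnl, if_neg this, hnl, show pdeg C l = m from hlT]; linarith
      · by_cases hnk : n = k
        · rw [if_neg hnl, if_pos hnk, hnk, show pdeg C k = m from hkT]; linarith
        · rw [if_neg hnl, if_neg hnk]
          linarith [hpos n]
    rw [h1, sum_add_distrib, sum_add_distrib, sum_ite_eq', sum_ite_eq', if_pos (mem_lns.2 hpl),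
      if_pos (mem_lns.2 hpk), sum_const, card_lns, nsmul_eq_mul] at h2
    push_cast at h2
    linarith
  have hcardT : ∀ l ∈ T, (C.filter (· ∈ l)).card = m := by
    intro l hlT
    have : pdeg C l = m := hlT
    rw [pdeg_eq_card] at this
    exact_mod_cast this
  have hcard : (C.card : ℤ) = (m : ℤ) ^ 2 - m + 1 := by rw [hC, hq]; ring
  have hm' : (3 : ℤ) ≤ m := by exact_mod_cast hm
  refine ⟨T, m - 1, ?_, ?_⟩
  · have : ((m - 1 : ℕ) : ℤ) = (m : ℤ) - 1 := by push_cast [show 1 ≤ m by omega]; ring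
    have h2 : (((m - 1) ^ 2 : ℕ) : ℤ) = (order P L : ℕ) := by rw [hq]; push_cast [this]; ring
    exact_mod_cast h2
  -- a configuration in general position
  obtain ⟨p₂, hp₂, p₃, hp₃, hp23⟩ : ∃ a ∈ C, ∃ b ∈ C, a ≠ b := by
    refine one_lt_card.1 ?_
    have : (1 : ℤ) < C.card := by rw [hcard]; nlinarith
    exact_mod_cast this
  obtain ⟨l₂, h22, h32⟩ := exists_line_mem L p₂ p₃
  have hl₂ : l₂ ∈ T := hline p₂ hp₂ p₃ hp₃ hp23 l₂ h22 h32
  have hlt2 : (C.filter (· ∈ l₂)).card < C.card := by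
    rw [hcardT l₂ hl₂]
    have : (m : ℤ) < C.card := by rw [hcard]; nlinarith
    exact_mod_cast this
  obtain ⟨a, ha, ha2⟩ : ∃ a ∈ C, a ∉ l₂ := by
    obtain ⟨a, ha, ha'⟩ := exists_mem_notMem_of_card_lt_card hlt2
    exact ⟨a, ha, fun h => ha' (mem_filter.2 ⟨ha, h⟩)⟩
  have hap₂ : p₂ ≠ a := fun e => ha2 (e ▸ h22)
  obtain ⟨l₃, h23, ha3⟩ := exists_line_mem L p₂ a
  have hl₃ : l₃ ∈ T := hline p₂ hp₂ a ha hap₂ l₃ h23 ha3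
  have hl23 : l₂ ≠ l₃ := fun e => ha2 (e ▸ ha3)
  have h33 : p₃ ∉ l₃ := fun e => hp23 (eq_of_mem_mem h22 h32 h23 e hl23)
  obtain ⟨p₁, hp₁, h12, h13⟩ : ∃ p ∈ C, p ∉ l₂ ∧ p ∉ l₃ := by
    have : ((C.filter (· ∈ l₂)) ∪ (C.filter (· ∈ l₃))).card < C.card := by
      refine lt_of_le_of_lt (card_union_le _ _) ?_
      rw [hcardT l₂ hl₂, hcardT l₃ hl₃]
      have : (m + m : ℤ) < C.card := by rw [hcard]; nlinarith
      exact_mod_cast this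
    obtain ⟨p, hp, hp'⟩ := exists_mem_notMem_of_card_lt_card this
    simp only [mem_union, mem_filter, not_or, not_and] at hp'
    exact ⟨p, hp, hp'.1 hp, hp'.2 hp⟩
  -- A third point of `l₂`, available because `m ≥ 3`: the line from `p₁` to it avoids `p₂` and
  -- `p₃`.
  obtain ⟨b, hb, hb2, hbp₂, hbp₃⟩ : ∃ b ∈ C, b ∈ l₂ ∧ b ≠ p₂ ∧ b ≠ p₃ := by
    have : ({p₂, p₃} : Finset P).card < (C.filter (· ∈ l₂)).card := by
      rw [hcardT l₂ hl₂, card_pair hp23]; omega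
    obtain ⟨b, hb, hb'⟩ := exists_mem_notMem_of_card_lt_card this
    simp only [mem_filter] at hb
    simp only [mem_insert, mem_singleton, not_or] at hb'
    exact ⟨b, hb.1, hb.2, hb'.1, hb'.2⟩
  have hp₁b : p₁ ≠ b := fun e => h12 (e ▸ hb2)
  obtain ⟨l₁, h11, hb1⟩ := exists_line_mem L p₁ b
  have hl₁ : l₁ ∈ T := hline p₁ hp₁ b hb hp₁b l₁ h11 hb1
  have hl12 : l₁ ≠ l₂ := fun e => h12 (e ▸ h11)
  have h21 : p₂ ∉ l₁ := fun e => hbp₂ (eq_of_mem_mem hb1 e hb2 h22 hl12)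
  have h31 : p₃ ∉ l₁ := fun e => hbp₃ (eq_of_mem_mem hb1 e hb2 h32 hl12)
  choose f hf1 hf2 using fun l k : L => exists_point_mem P l k
  choose g hg1 hg2 using fun p r : P => exists_line_mem L p r
  let _ : Membership (C : Set P) T := ⟨fun l p => (p : P) ∈ (l : L)⟩
  let inst : ProjectivePlane (C : Set P) T :=
    { exists_point := by
        rintro ⟨l, hlT⟩
        have : (C.filter (· ∈ l)).card < C.card := by
          rw [hcardT l hlT]
          have : (m : ℤ) < C.card := by rw [hcard]; nlinarith
          exact_mod_cast this
        obtain ⟨p, hp, hp'⟩ := exists_mem_notMem_of_card_lt_card this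
        exact ⟨⟨p, hp⟩, fun h => hp' (mem_filter.2 ⟨hp, h⟩)⟩
      exists_line := by
        rintro ⟨p, hp⟩
        by_cases h1 : p ∈ l₁
        · by_cases h2 : p ∈ l₂
          · refine ⟨⟨l₃, hl₃⟩, fun h3 => ?_⟩
            have h3' : p ∈ l₃ := h3
            exact h21 ((eq_of_mem_mem h2 h22 h3' h23 hl23) ▸ h1)
          · exact ⟨⟨l₂, hl₂⟩, h2⟩
        · exact ⟨⟨l₁, hl₁⟩, h1⟩
      eq_or_eq := by
        rintro ⟨p, hp⟩ ⟨r, hr⟩ ⟨l, hl⟩ ⟨k, hk⟩ h1 h2 h3 h4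
        rcases eq_or_eq (P := P) (L := L) (p₁ := p) (p₂ := r) (l₁ := l) (l₂ := k) h1 h2 h3 h4 with
          h | h
        · exact Or.inl (Subtype.ext h)
        · exact Or.inr (Subtype.ext h)
      mkPoint := fun {l k} h => ⟨f l k, hpoint l l.2 k k.2 (fun e => h (Subtype.ext e)) _
        (hf1 l k) (hf2 l k)⟩
      mkPoint_ax := fun {l k} h => ⟨hf1 l k, hf2 l k⟩
      mkLine := fun {p r} h => ⟨g p r, hline p p.2 r r.2 (fun e => h (Subtype.ext e)) _
        (hg1 p r) (hg2 p r)⟩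
      mkLine_ax := fun {p r} h => ⟨hg1 p r, hg2 p r⟩
      exists_config := ⟨⟨p₁, hp₁⟩, ⟨p₂, hp₂⟩, ⟨p₃, hp₃⟩, ⟨l₁, hl₁⟩, ⟨l₂, hl₂⟩, ⟨l₃, hl₃⟩,
        h12, h13, h21, h22, h23, h31, h32, h33⟩ }
  refine ⟨inst, ?_⟩
  have hfin : Finite T := inferInstance
  have hcount := pointCount_eq (C : Set P) (⟨l₁, hl₁⟩ : T)
  have hpc : pointCount (C : Set P) (⟨l₁, hl₁⟩ : T) = m := by
    rw [← hcardT l₁ hl₁, pointCount, ← Fintype.card_coe, ← Nat.card_eq_fintype_card]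
    exact Nat.card_congr
      { toFun := fun p => ⟨p.1.1, mem_filter.2 ⟨p.1.2, p.2⟩⟩
        invFun := fun p => ⟨⟨p.1, (mem_filter.1 p.2).1⟩, (mem_filter.1 p.2).2⟩
        left_inv := fun _ => rfl
        right_inv := fun _ => rfl }
  have h3 : order (C : Set P) T + 1 = m := hcount.symm.trans hpc
  change order (C : Set P) T = m - 1
  omega

end Baer

/-! ### Classification of minimal dominating sets with nearly a full pencil -/

section PencilOutcome

open Finset HasPoints HasLines Nondegenerate
open scoped Classical

variable {P L : Type*} [Membership P L]

/-- A set with an essential line for each of its points, and which blocks after adding at most one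
point, is a minimal blocking set up to at most one point. -/
theorem exists_minimal_blocking {A : Set P} {x : P} {F : Set P → Prop} {N : P → Prop}
    {Q : L → Prop} (hF : ∀ X, F X ↔ (∀ p ∈ X, N p) ∧ ∀ l, Q l → ∃ p ∈ X, p ∈ l)
    (hC : F (insert x A))
    (htan : ∀ p ∈ A, ∃ l, Q l ∧ x ∉ l ∧ p ∈ l ∧ ∀ r ∈ A, r ∈ l → r = p) :
    ∃ X, Minimal F X ∧ X ⊆ insert x A ∧ AllButAtMostOne A X := by
  -- If `A` fails to block, `x` is essential in `insert x A`; the points of `A` stay essential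
  -- because their private lines avoid `x`.
  by_cases hA : F A
  · refine ⟨A, ⟨hA, fun X hX hXA p hp => ?_⟩, Set.subset_insert _ _, Set.Subset.rfl, by simp⟩
    obtain ⟨l, hQ, -, -, hl⟩ := htan p hp
    obtain ⟨r, hr, hrl⟩ := ((hF X).1 hX).2 l hQ
    exact hl r (hXA hr) hrl ▸ hr
  · refine ⟨insert x A, ⟨hC, fun X hX hXC p hp => ?_⟩, Set.Subset.rfl, Set.subset_insert _ _, ?_⟩
    · rcases hp with rfl | hp
      · rw [hF] at hA
        have hN : ∀ r ∈ A, N r := fun r hr => ((hF _).1 hC).1 r (Set.mem_insert_of_mem _ hr)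
        have : ¬ ∀ l, Q l → ∃ p ∈ A, p ∈ l := fun h => hA ⟨hN, h⟩
        push Not at this
        obtain ⟨l, hQ, hl⟩ := this
        obtain ⟨r, hr, hrl⟩ := ((hF X).1 hX).2 l hQ
        rcases hXC hr with rfl | hrA
        · exact hr
        · exact absurd hrl (hl r hrA)
      · obtain ⟨l, hQ, hxl, -, hl⟩ := htan p hp
        obtain ⟨r, hr, hrl⟩ := ((hF X).1 hX).2 l hQ
        rcases hXC hr with rfl | hrA
        · exact absurd hrl hxl
        · exact hl r hrA hrl ▸ hr
    · refine (Set.encard_le_encard (t := {x}) ?_).trans (by simp)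
      rintro p ⟨rfl | hp, hpA⟩
      · rfl
      · exact absurd hp hpA

variable [Fintype P] [Fintype L]

/-- Some superset with one more element contains a smaller dominating set. -/
def Unstable (A : Finset P) (B : Finset L) : Prop :=
  ∃ A₁ B₁, A ⊆ A₁ ∧ B ⊆ B₁ ∧ A₁.card + B₁.card = A.card + B.card + 1 ∧
    ∃ A₂ B₂, A₂ ⊆ A₁ ∧ B₂ ⊆ B₁ ∧ Dom A₂ B₂ ∧ A₂.card + B₂.card < A.card + B.card

theorem Unstable.dual {A : Finset P} {B : Finset L} (h : Unstable A B) :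
    Unstable (P := Dual L) (L := Dual P) B A := by
  obtain ⟨A₁, B₁, hA, hB, h1, A₂, B₂, hA₂, hB₂, hD, h2⟩ := h
  exact ⟨B₁, A₁, hB, hA, (add_comm _ _).trans (h1.trans (congrArg (· + 1) (add_comm _ _))),
    B₂, A₂, hB₂, hA₂, hD.dual,
    lt_of_eq_of_lt (add_comm _ _) (lt_of_lt_of_eq h2 (add_comm _ _))⟩

theorem unstable_of_swap {A : Finset P} {B : Finset L} {z : P} {l₁ l₂ : L} (hz : z ∉ A)
    (h₁ : l₁ ∈ B) (h₂ : l₂ ∈ B) (hne : l₁ ≠ l₂)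
    (h : Dom (insert z A) ((B.erase l₁).erase l₂)) : Unstable A B := by
  refine ⟨insert z A, B, subset_insert _ _, Subset.rfl, ?_, _, _, Subset.rfl,
    (erase_subset _ _).trans (erase_subset _ _), h, ?_⟩
  · rw [card_insert_of_notMem hz]; ring
  · have h3 : l₂ ∈ B.erase l₁ := mem_erase.2 ⟨hne.symm, h₂⟩
    have h4 := card_erase_add_one h₁
    have h5 := card_erase_add_one h3
    rw [card_insert_of_notMem hz]
    omega

variable [ProjectivePlane P L]

/-- The possible shapes of a minimal dominating set containing all but at most one of the lines
of a pencil. -/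
inductive PencilOutcome (A : Finset P) (B : Finset L) : Prop
  | erased (x : P) (l : L) (hxl : x ∈ l) (hA : A = (pts P l).erase x)
      (hB : B = (lns L x).erase l)
  | full (x : P) (l : L) (hxl : x ∉ l) (hA : A = pts P l) (hB : B = lns L x)
  | large (h : 3 * (order P L : ℤ) - 1 ≤ A.card + B.card)
  | projective (x : P) (n : ℤ) (hn : (A.card : ℤ) + B.card = 2 * order P L + 1 + n) (hn0 : 0 ≤ n)
      (hB : B = lns L x)
      (htype : IsProjectiveBlockingType (A : Set P) (B : Set L))
      (hpdeg : ∀ l : L, pdeg A l ≤ n + 1) (hq : (order P L : ℤ) ≤ n ^ 2)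
      (heq : (order P L : ℤ) = n ^ 2 → IsBaerType (A : Set P) (B : Set L))
  | affine (n : ℤ) (hn : (A.card : ℤ) + B.card = 2 * order P L + 1 + n) (hn0 : 0 ≤ n)
      (hq : (order P L : ℤ) < n ^ 2)
      (htype : IsAffineBlockingType (A : Set P) (B : Set L) ∨ Unstable A B)

theorem MinDom.pencilOutcome_of_eq {A : Finset P} {B : Finset L} (h : MinDom A B) {x : P}
    (hx : ldeg B x = order P L) : PencilOutcome A B := by
  have h1 := card_lns_sdiff B x
  rw [hx] at h1
  have h2 : (lns L x \ B).card = 1 := by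
    have : ((lns L x \ B).card : ℤ) = 1 := by rw [h1]; ring
    exact_mod_cast this
  obtain ⟨l, hl⟩ := card_eq_one.1 h2
  have hl' : l ∈ lns L x \ B := by rw [hl]; exact mem_singleton_self l
  simp only [mem_sdiff, mem_lns] at hl'
  have hsub : (lns L x).erase l ⊆ B := by
    intro m hm
    simp only [mem_erase] at hm
    by_contra hmB
    have : m ∈ lns L x \ B := mem_sdiff.2 ⟨hm.2, hmB⟩
    rw [hl, mem_singleton] at this
    exact hm.1 this
  rcases h.1.pts_subset_or_large hl'.1 hl'.2 hx with h3 | h3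
  · obtain ⟨h4, h5⟩ := h.2 _ h3 _ hsub (dom_pts_lns_erase hl'.1)
    exact .erased x l hl'.1 h4.symm h5.symm
  · exact .large h3

/-- The pencil of `x` already dominates all points, so `A` only has to meet the lines outside `B`.
By minimality `x ∉ A`, lines of `B` off `x` miss `A`, and each point of `A` has a private line. Thus
the skew lines of `A ∪ {x}` are exactly the extra lines of `B`, and their number `r` distinguishes
the outcomes. -/
theorem MinDom.pencilOutcome_of_subset {A : Finset P} {B : Finset L} (h : MinDom A B)
    (hq5 : 5 ≤ order P L) {x : P} (hx : lns L x ⊆ B) : PencilOutcome A B := by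
  have hxl : ∀ {l : L}, l ∉ B → x ∉ l := fun hl hxl => hl (hx (mem_lns.2 hxl))
  have hxA : x ∉ A := by
    intro hxA
    have := (h.2 (A.erase x) (erase_subset _ _) B Subset.rfl (dom_of_pencil hx fun l hl => by
      obtain ⟨p, hp, hpl⟩ := h.1.2 l hl
      exact ⟨p, mem_erase.2 ⟨fun e => hxl hl (e ▸ hpl), hp⟩, hpl⟩)).1
    exact notMem_erase x A (this.symm ▸ hxA)
  have hskew : ∀ l ∈ B, x ∉ l → ∀ p ∈ A, p ∉ l := by
    intro l hl hxl' p hp hpl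
    have := (h.2 A Subset.rfl (B.erase l) (erase_subset _ _) (dom_of_pencil (x := x) ?_ ?_)).2
    · exact notMem_erase l B (this.symm ▸ hl)
    · intro m hm
      exact mem_erase.2 ⟨fun e => hxl' (e ▸ mem_lns.1 hm), hx hm⟩
    · intro m hm
      by_cases hml : m = l
      · exact ⟨p, hp, hml ▸ hpl⟩
      · exact h.1.2 m fun hmB => hm (mem_erase.2 ⟨hml, hmB⟩)
  have htan : ∀ p ∈ A, ∃ l, l ∉ B ∧ x ∉ l ∧ p ∈ l ∧ ∀ r ∈ A, r ∈ l → r = p := by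
    intro p hp
    by_contra hcon
    push Not at hcon
    have := (h.2 (A.erase p) (erase_subset _ _) B Subset.rfl (dom_of_pencil hx fun l hl => by
      obtain ⟨r, hr, hrl⟩ := h.1.2 l hl
      by_cases hrp : r = p
      · subst hrp
        obtain ⟨s, hs, hsl, hsr⟩ := hcon l hl (hxl hl) hrl
        exact ⟨s, mem_erase.2 ⟨hsr, hs⟩, hsl⟩
      · exact ⟨r, mem_erase.2 ⟨hrp, hr⟩, hrl⟩)).1
    exact notMem_erase p A (this.symm ▸ hp)
  by_cases hlarge : 3 * (order P L : ℤ) - 1 ≤ A.card + B.card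
  · exact .large hlarge
  by_cases hfull : ∃ l : L, pts P l ⊆ insert x A
  · obtain ⟨l, hl⟩ := hfull
    by_cases hxl' : x ∈ l
    · exfalso
      have hsub : (pts P l).erase x ⊆ A := fun p hp => by
        have := hl (mem_of_mem_erase hp)
        exact (mem_insert.1 this).resolve_left (ne_of_mem_erase hp)
      have := (h.2 _ hsub _ ((erase_subset l _).trans hx) (dom_pts_lns_erase hxl')).2
      have hlB : l ∈ B := hx (mem_lns.2 hxl')
      rw [← this] at hlB
      exact notMem_erase _ _ hlB
    · have hsub : pts P l ⊆ A := fun p hp =>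
        (mem_insert.1 (hl hp)).resolve_left fun e => hxl' (e ▸ mem_pts.1 hp)
      obtain ⟨h4, h5⟩ := h.2 _ hsub _ hx (dom_pts_lns x l)
      exact .full x l hxl' h4.symm h5.symm
  push Not at hfull
  set C := insert x A with hCdef
  have hsk : skew L C = B.filter (x ∉ ·) := by
    ext l
    rw [mem_skew, pdeg_eq_zero_iff, mem_filter]
    constructor
    · intro hl
      refine ⟨?_, hl x (mem_insert_self _ _)⟩
      by_contra hlB
      obtain ⟨p, hp, hpl⟩ := h.1.2 l hlB
      exact hl p (mem_insert_of_mem hp) hpl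
    · rintro ⟨hlB, hxl'⟩ p hp
      rcases mem_insert.1 hp with rfl | hp
      · exact hxl'
      · exact hskew l hlB hxl' p hp
  have hcardC : (C.card : ℤ) = A.card + 1 := by
    rw [hCdef, card_insert_of_notMem hxA]; push_cast; ring
  have hcardB : (B.card : ℤ) = order P L + 1 + (skew L C).card := by
    have h1 : B.filter (x ∈ ·) = lns L x := by
      ext l
      simp only [mem_filter, mem_lns]
      exact ⟨fun h => h.2, fun h => ⟨hx (mem_lns.2 h), h⟩⟩
    have h2 := card_filter_add_card_filter_not (s := B) (x ∈ · : L → Prop)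
    rw [h1, ← hsk, card_lns] at h2
    rw [← h2]; push_cast; ring
  obtain ⟨m, hm⟩ : ∃ m : ℤ, (C.card : ℤ) = order P L + m := ⟨C.card - order P L, by ring⟩
  obtain ⟨r, hr⟩ : ∃ r : ℕ, (skew L C).card = r := ⟨_, rfl⟩
  have hsmall : (C.card : ℤ) + (skew L C).card < 2 * order P L := by
    rw [hcardC]; linarith
  have hq5' : (5 : ℤ) ≤ order P L := by exact_mod_cast hq5
  have hbruen := bruen_skew hsmall hfull hm
  have hpdegC : ∀ l : L, l ∉ skew L C → pdeg C l ≤ m := fun l hl => by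
    have := pdeg_le_of_small hsmall hl (hfull l)
    linarith
  have hm1 : 1 ≤ m := by
    obtain ⟨l, hl, -⟩ := exists_line_mem L x x
    have h1 : 1 ≤ pdeg C l := one_le_pdeg_iff.2 ⟨x, mem_insert_self _ _, hl⟩
    have h2 := hpdegC l (by rw [mem_skew]; omega)
    linarith
  have hn : (A.card : ℤ) + B.card = 2 * order P L + 1 + (m - 1 + r) := by
    rw [hcardB, hr]; linarith
  have hblock : ∀ l : L, l ∉ skew L C → ∃ p ∈ insert x (A : Set P), p ∈ l := by
    intro l hl
    rw [mem_skew] at hl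
    have h1 : 1 ≤ pdeg C l := by
      have := pdeg_nonneg C l
      omega
    obtain ⟨p, hp, hpl⟩ := one_le_pdeg_iff.1 h1
    exact ⟨p, by simpa [hCdef] using hp, hpl⟩
  have hr0 : (0 : ℤ) ≤ r := Int.natCast_nonneg r
  rw [hr] at hbruen
  rcases Nat.eq_zero_or_pos r with hr0' | hr1
  · rw [hr0', card_eq_zero] at hr
    have hBx : B = lns L x := by
      refine Subset.antisymm (fun l hl => mem_lns.2 ?_) hx
      by_contra hxl'
      have : l ∈ skew L C := by rw [hsk]; exact mem_filter.2 ⟨hl, hxl'⟩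
      rw [hr] at this
      exact notMem_empty _ this
    have hBp : (B : Set L) = pencil L x := by
      rw [hBx]; ext l; simp [pencil]
    rw [hr0', Nat.cast_zero, mul_zero] at hbruen
    refine .projective x (m - 1) ?_ (by linarith) hBx ⟨⟨x, hBp⟩, ?_⟩ ?_ ?_ ?_
    · rw [hn, hr0']; push_cast; ring
    · obtain ⟨X, hX, hXC, hAX⟩ := exists_minimal_blocking (L := L) (A := (A : Set P)) (x := x)
        (F := IsBlocking L) (N := fun _ => True) (Q := fun _ => True)
        (fun X => by simp [IsBlocking]) (fun l => hblock l (by rw [hr]; exact notMem_empty l))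
        (fun p hp => by
          obtain ⟨l, -, h1, h2, h3⟩ := htan p hp
          exact ⟨l, trivial, h1, h2, h3⟩)
      refine ⟨X, ⟨hX, fun l hl => hfull l fun p hp => ?_⟩, hAX⟩
      have := hXC (hl (mem_pts.1 hp : p ∈ l))
      simpa [hCdef] using this
    · intro l
      have h1 : pdeg A l ≤ pdeg C l := by
        rw [pdeg_eq_card, pdeg_eq_card]
        exact_mod_cast card_le_card (filter_subset_filter _ (subset_insert _ _))
      have h2 := hpdegC l (by rw [hr]; exact notMem_empty l)
      linarith
    · nlinarith
    · intro heq
      have hm3 : 3 ≤ m := by nlinarith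
      refine ⟨(C : Set P), x, ?_, by simp [hCdef], hBp, ?_⟩
      · refine isBaerSubplane_of_pdeg (m := m.toNat) (by omega) ?_ ?_ ?_
        · rw [hm, Int.toNat_of_nonneg (by omega)]
        · rw [heq, Int.toNat_of_nonneg (by omega)]
        · rw [Int.toNat_of_nonneg (by omega)]
          exact bruen_eq (by rw [hr] at hsmall; simpa using hsmall) hr hfull hm heq
      · rw [hCdef]; ext p
        simp only [coe_insert, Set.mem_sdiff, Set.mem_insert_iff, mem_coe, Set.mem_singleton_iff]
        constructor
        · intro hp
          exact ⟨Or.inr hp, fun e => hxA (e ▸ hp)⟩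
        · rintro ⟨h1 | h1, h2⟩
          · exact absurd h1 h2
          · exact h1
  · have hr1' : (1 : ℤ) ≤ r := by exact_mod_cast hr1
    refine .affine (m - 1 + r) hn (by linarith) ?_ ?_
    -- If `(m - 1 + r)² ≤ q`, then `bruen_skew` yields `q (r + 2(m - 1)) ≤ m` after division by `r`,
    -- impossible for `q ≥ 5` and `r, m ≥ 1`.
    · by_contra hcon
      push Not at hcon
      have h1 : (order P L : ℤ) * (r * (r + 2 * (m - 1))) ≤ r * m := by
        refine le_trans (mul_le_mul_of_nonneg_left ?_ (by linarith)) (hbruen.trans_eq (by ring))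
        linarith
      have h2 : (r : ℤ) * (5 * (r + 2 * (m - 1))) ≤ r * m := by
        refine le_trans ?_ h1
        have h3 : (0 : ℤ) ≤ r * (r + 2 * (m - 1)) := mul_nonneg hr0 (by linarith)
        nlinarith
      have h4 := le_of_mul_le_mul_left h2 (by linarith : (0 : ℤ) < r)
      linarith
    · rcases Nat.eq_or_lt_of_le hr1 with hr1 | hr2
      · left
        rw [← hr1] at hr
        obtain ⟨l₀, hl₀⟩ := card_eq_one.1 hr
        have hl₀' : l₀ ∈ B ∧ x ∉ l₀ := by
          have : l₀ ∈ skew L C := by rw [hl₀]; exact mem_singleton_self _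
          rw [hsk] at this
          exact mem_filter.1 this
        refine ⟨l₀, ⟨x, hl₀'.2, ?_⟩, ?_⟩
        · ext l
          simp only [mem_coe, pencil, Set.mem_union, Set.mem_ofPred_eq, Set.mem_singleton_iff]
          constructor
          · intro hl
            by_cases hxl' : x ∈ l
            · exact Or.inl hxl'
            · right
              have : l ∈ skew L C := by rw [hsk]; exact mem_filter.2 ⟨hl, hxl'⟩
              rwa [hl₀, mem_singleton] at this
          · rintro (hl | rfl)
            · exact hx (mem_lns.2 hl)
            · exact hl₀'.1
        · obtain ⟨X, hX, -, hAX⟩ := exists_minimal_blocking (L := L) (A := (A : Set P)) (x := x)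
            (F := IsAffineBlocking l₀) (N := fun p => p ∉ l₀) (Q := fun l => l ≠ l₀)
            (fun X => Iff.rfl)
            ⟨by
              rintro p (rfl | hp)
              · exact hl₀'.2
              · exact hskew l₀ hl₀'.1 hl₀'.2 p hp,
             fun l hl => hblock l (by rw [hl₀, mem_singleton]; exact hl)⟩
            (fun p hp => by
              obtain ⟨l, h0, h1, h2, h3⟩ := htan p hp
              exact ⟨l, fun e => h0 (e ▸ hl₀'.1), h1, h2, h3⟩)
          exact ⟨X, hX, hAX⟩
      -- Two extra lines are dominated by their common point `z`, so adding `z` and deleting both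
      -- lowers the size by one.
      · right
        rw [← hr] at hr2
        obtain ⟨l₁, hl₁, l₂, hl₂, hne⟩ := one_lt_card.1 hr2
        rw [hsk, mem_filter] at hl₁ hl₂
        obtain ⟨z, hz1, hz2⟩ := exists_point_mem P l₁ l₂
        refine unstable_of_swap (z := z) (fun hz => hskew l₁ hl₁.1 hl₁.2 z hz hz1) hl₁.1 hl₂.1 hne
          (dom_of_pencil (x := x) ?_ ?_)
        · intro l hl
          rw [mem_lns] at hl
          exact mem_erase.2 ⟨fun e => hl₂.2 (e ▸ hl),
            mem_erase.2 ⟨fun e => hl₁.2 (e ▸ hl), hx (mem_lns.2 hl)⟩⟩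
        · intro l hl
          by_cases h1 : l = l₁
          · exact ⟨z, mem_insert_self _ _, h1 ▸ hz1⟩
          by_cases h2 : l = l₂
          · exact ⟨z, mem_insert_self _ _, h2 ▸ hz2⟩
          obtain ⟨p, hp, hpl⟩ := h.1.2 l fun hlB => hl (mem_erase.2 ⟨h2, mem_erase.2 ⟨h1, hlB⟩⟩)
          exact ⟨p, mem_insert_of_mem hp, hpl⟩

theorem MinDom.pencilOutcome {A : Finset P} {B : Finset L} (h : MinDom A B)
    (hq5 : 5 ≤ order P L) {x : P} (hx : (order P L : ℤ) ≤ ldeg B x) : PencilOutcome A B := by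
  rcases hx.eq_or_lt with hx | hx
  · exact h.pencilOutcome_of_eq hx.symm
  · refine h.pencilOutcome_of_subset (x := x) hq5 ?_
    have h1 := card_lns_sdiff B x
    have h2 : (lns L x \ B).card = 0 := by
      have := ldeg_le B x
      omega
    rwa [card_eq_zero, sdiff_eq_empty_iff_subset] at h2

end PencilOutcome

/-! ### Stability of small minimal dominating sets -/

section Stability

open Finset HasPoints HasLines Nondegenerate
open scoped Classical

variable {P L : Type*} [Membership P L] [Fintype P] [Fintype L]

theorem Dom.exists_minDom {A : Finset P} {B : Finset L} (h : Dom A B) :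
    ∃ A' ⊆ A, ∃ B' ⊆ B, MinDom A' B' := by
  obtain ⟨⟨A', B'⟩, hm, hmin⟩ := exists_min_image
    ((A.powerset ×ˢ B.powerset).filter fun X => Dom X.1 X.2) (fun X => X.1.card + X.2.card)
    ⟨(A, B), by simp [h]⟩
  simp only [mem_filter, mem_product, mem_powerset] at hm hmin
  refine ⟨A', hm.1.1, B', hm.1.2, hm.2, fun A₁ hA B₁ hB hD => ?_⟩
  have h1 := hmin (A₁, B₁) ⟨⟨hA.trans hm.1.1, hB.trans hm.1.2⟩, hD⟩
  have h2 := card_le_card hA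
  have h3 := card_le_card hB
  simp only at h1
  exact ⟨eq_of_subset_of_card_le hA (by omega), eq_of_subset_of_card_le hB (by omega)⟩

variable [ProjectivePlane P L]

/-- One of the two smallest primal examples. -/
def IsSmallExample (A : Finset P) (B : Finset L) : Prop :=
  ∃ (x : P) (l : L), (x ∈ l ∧ A = (pts P l).erase x ∧ B = (lns L x).erase l) ∨
    (x ∉ l ∧ A = pts P l ∧ B = lns L x)

/-- The blocking-set outcomes have size `2q + 1 + n` with `n² ≥ q ≥ s²`, which exceeds `2q + s`. -/
theorem PencilOutcome.isSmallExample {A : Finset P} {B : Finset L} (h : PencilOutcome A B) {s : ℤ}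
    (hs0 : 0 ≤ s) (hs : s ^ 2 ≤ order P L) (hq5 : 5 ≤ order P L)
    (hcard : (A.card : ℤ) + B.card ≤ 2 * order P L + s) : IsSmallExample A B := by
  have hq5' : (5 : ℤ) ≤ order P L := by exact_mod_cast hq5
  cases h with
  | erased x l hxl hA hB => exact ⟨x, l, Or.inl ⟨hxl, hA, hB⟩⟩
  | full x l hxl hA hB => exact ⟨x, l, Or.inr ⟨hxl, hA, hB⟩⟩
  | large h => nlinarith
  | projective x n hn hn0 hB htype hpdeg hq heq => nlinarith
  | affine n hn hn0 hq htype => nlinarith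

theorem MinDom.isSmallExample {A : Finset P} {B : Finset L} (h : MinDom A B) {s : ℤ}
    (hs0 : 0 ≤ s) (hs : s ^ 2 ≤ order P L) (hq5 : 5 ≤ order P L)
    (hcard : (A.card : ℤ) + B.card ≤ 2 * order P L + s)
    (hprimal : (∃ x, (order P L : ℤ) ≤ ldeg B x) ∨ ∃ l : L, (order P L : ℤ) ≤ pdeg A l) :
    IsSmallExample A B := by
  rcases hprimal with ⟨x, hx⟩ | ⟨l, hl⟩
  · exact (h.pencilOutcome hq5 hx).isSmallExample hs0 hs hq5 hcard
  · have h1 : PencilOutcome (P := Dual L) (L := Dual P) B A :=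
      MinDom.pencilOutcome (P := Dual L) (L := Dual P) h.dual (by rw [Dual.order]; exact hq5)
        (x := l) (by rw [Dual.order]; exact hl)
    obtain ⟨l, x, hlx⟩ := PencilOutcome.isSmallExample (P := Dual L) (L := Dual P) h1 hs0
      (by rw [Dual.order]; exact hs) (by rw [Dual.order]; exact hq5)
      (by rw [Dual.order, add_comm]; exact hcard)
    refine ⟨x, l, ?_⟩
    rcases hlx with ⟨h1, h2, h3⟩ | ⟨h1, h2, h3⟩
    · exact Or.inl ⟨h1, h3, h2⟩
    · exact Or.inr ⟨h1, h3, h2⟩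

theorem card_pts_inter_le {l m : L} (h : l ≠ m) {S : Finset P} (h1 : S ⊆ pts P l)
    (h2 : S ⊆ pts P m) : S.card ≤ 1 := by
  refine card_le_one.2 fun a ha b hb => ?_
  exact eq_of_mem_mem (mem_pts.1 (h1 ha)) (mem_pts.1 (h1 hb)) (mem_pts.1 (h2 ha))
    (mem_pts.1 (h2 hb)) h

theorem card_lns_inter_le {x y : P} (h : x ≠ y) {S : Finset L} (h1 : S ⊆ lns L x)
    (h2 : S ⊆ lns L y) : S.card ≤ 1 := by
  refine card_le_one.2 fun a ha b hb => ?_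
  exact line_eq_of_mem_mem (mem_lns.1 (h1 ha)) (mem_lns.1 (h2 ha)) (mem_lns.1 (h1 hb))
    (mem_lns.1 (h2 hb)) h

/-- The smaller set must use `v`. If it is primal, it is a small example on some `x` and `l`, so `A`
has `q` points on `l` and `B` has at least `q - 1` lines through `x`. Hence the original set is
primal as well, and each dual pencil outcome contradicts its size or these two degrees. -/
theorem MinDom.not_dom_of_insert_line {A A₂ : Finset P} {B B₂ : Finset L} (h : MinDom A B)
    (hq5 : 5 ≤ order P L)
    (hcard : (A.card : ℤ) + B.card ≤ 2 * order P L + Nat.sqrt (order P L) + 1) {v : L}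
    (hv : v ∉ B) (hA₂ : A₂ ⊆ A) (hB₂ : B₂ ⊆ insert v B)
    (hlt : A₂.card + B₂.card < A.card + B.card) : ¬ MinDom A₂ B₂ := by
  intro hD
  obtain ⟨s, hsdef⟩ : ∃ s : ℕ, Nat.sqrt (order P L) = s := ⟨_, rfl⟩
  have hs : (s : ℤ) ^ 2 ≤ order P L := by
    have := Nat.sqrt_le' (order P L)
    rw [hsdef] at this
    exact_mod_cast this
  rw [hsdef] at hcard
  have hs0 : (0 : ℤ) ≤ s := Int.natCast_nonneg s
  have hq5' : (5 : ℤ) ≤ order P L := by exact_mod_cast hq5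
  have hsq : (s : ℤ) + 2 < order P L := by nlinarith
  have hE : (A₂.card : ℤ) + B₂.card ≤ 2 * order P L + s := by
    have : (A₂.card : ℤ) + B₂.card < A.card + B.card := by exact_mod_cast hlt
    linarith
  have hE2 := hD.1.two_mul_order_le
  have herase : B₂.erase v ⊆ B := fun m hm =>
    (mem_insert.1 (hB₂ (mem_of_mem_erase hm))).resolve_left (ne_of_mem_erase hm)
  have hvB₂ : v ∈ B₂ := by
    by_contra hvB
    rw [erase_eq_of_notMem hvB] at herase
    obtain ⟨rfl, rfl⟩ := h.2 A₂ hA₂ B₂ herase hD.1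
    exact lt_irrefl _ hlt
  by_cases hprimal : (∃ x, (order P L : ℤ) ≤ ldeg B₂ x) ∨ ∃ l : L, (order P L : ℤ) ≤ pdeg A₂ l
  · obtain ⟨x, l, hE⟩ := hD.isSmallExample hs0 hs hq5 hE hprimal
    have hsub : (pts P l).erase x ⊆ A ∧ ((lns L x).erase l).erase v ⊆ B := by
      rcases hE with ⟨-, h1, h2⟩ | ⟨-, h1, h2⟩
      · exact ⟨h1 ▸ hA₂, h2 ▸ herase⟩
      · exact ⟨(erase_subset _ _).trans (h1 ▸ hA₂),
          (erase_subset_erase _ (erase_subset _ _)).trans (h2 ▸ herase)⟩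
    have hc1 : order P L ≤ ((pts P l).erase x).card := by
      have := pred_card_le_card_erase (s := pts P l) (a := x)
      rw [card_pts] at this
      exact this
    have hc2 : order P L - 1 ≤ (((lns L x).erase l).erase v).card := by
      have h1 := pred_card_le_card_erase (s := lns L x) (a := l)
      have h2 := pred_card_le_card_erase (s := (lns L x).erase l) (a := v)
      rw [card_lns] at h1
      omega
    have hpdeg : (order P L : ℤ) ≤ pdeg A l := by
      rw [pdeg_eq_card]
      have : (pts P l).erase x ⊆ A.filter (· ∈ l) := fun p hp =>
        mem_filter.2 ⟨hsub.1 hp, mem_pts.1 (mem_of_mem_erase hp)⟩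
      exact_mod_cast hc1.trans (card_le_card this)
    have hldeg : (order P L : ℤ) - 1 ≤ ldeg B x := by
      rw [ldeg_eq_card]
      have : ((lns L x).erase l).erase v ⊆ B.filter (x ∈ ·) := fun p hp =>
        mem_filter.2 ⟨hsub.2 hp, mem_lns.1 (mem_of_mem_erase (mem_of_mem_erase hp))⟩
      have := hc2.trans (card_le_card this)
      omega
    have hout : PencilOutcome (P := Dual L) (L := Dual P) B A :=
      MinDom.pencilOutcome (P := Dual L) (L := Dual P) h.dual (by rw [Dual.order]; exact hq5)
        (x := l) (by rw [Dual.order]; exact hpdeg)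
    have herased : ∀ (l' : L) (x' : P), x' ∈ l' → B = (lns L x').erase l' →
        A = (pts P l').erase x' → False := by
      intro l' x' hlx hB hA
      have h1 : A.card = order P L := by
        rw [hA, card_erase_of_mem (mem_pts.2 hlx), card_pts]; rfl
      have h2 : B.card = order P L := by
        rw [hB, card_erase_of_mem (mem_lns.2 hlx), card_lns]; rfl
      omega
    have hfull : ∀ (l' : L) (x' : P), x' ∉ l' → B = lns L x' → A = pts P l' → False := by
      intro l' x' hlx hB hA
      have hl : l = l' := by
        by_contra hne
        have := card_pts_inter_le hne (erase_subset x _) (hA ▸ hsub.1)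
        omega
      have hx : x = x' := by
        by_contra hne
        have := card_lns_inter_le hne ((erase_subset v _).trans (erase_subset l _))
          (hB ▸ hsub.2)
        omega
      subst hl hx
      rcases hE with ⟨h1, -, -⟩ | ⟨-, h1, h2⟩
      · exact hlx h1
      · rw [h1, h2, hA, hB] at hlt
        exact lt_irrefl _ hlt
    cases hout with
    | erased l' x' hlx hB hA => exact herased l' x' hlx hB hA
    | full l' x' hlx hB hA => exact hfull l' x' hlx hB hA
    | large hl =>
      rw [Dual.order] at hl
      have : 3 * (order P L : ℤ) - 1 ≤ B.card + A.card := hl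
      linarith
    | projective l' n hn hn0 hB htype hdeg hq heq =>
      rw [Dual.order] at hn
      have hn' : (B.card : ℤ) + A.card = 2 * order P L + 1 + n := hn
      have : ldeg B x ≤ n + 1 := hdeg x
      linarith
    | affine n hn hn0 hq htype =>
      rw [Dual.order] at hn hq
      have hn' : (B.card : ℤ) + A.card = 2 * order P L + 1 + n := hn
      have : n ≤ s := by linarith
      nlinarith
  -- The smaller set is six-plus-six in order five, while the original set has at most `10 + 2 + 1 =
  -- 13` elements and lacks `v`.
  · push Not at hprimal
    obtain ⟨h1, h2, h3⟩ := small_nonprimal hD.1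
      (n := (A₂.card : ℤ) + B₂.card - 2 * order P L) (by ring) (by nlinarith) hq5
      (fun x => by have := hprimal.1 x; omega) (fun l => by have := hprimal.2 l; omega)
    refine six_six_exchange hD.1 h.1 h1 h3 h2 (fun x => ?_) hvB₂ hv hA₂ herase ?_
    · have := hprimal.1 x
      rw [h1] at this
      push_cast at this
      omega
    · rw [h1] at hcard hs
      push_cast at hcard hs
      have : (s : ℤ) ≤ 2 := by nlinarith
      have : (A.card : ℤ) + B.card ≤ 13 := by linarith
      exact_mod_cast this

theorem MinDom.not_unstable {A : Finset P} {B : Finset L} (h : MinDom A B) (hq5 : 5 ≤ order P L)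
    (hcard : (A.card : ℤ) + B.card ≤ 2 * order P L + Nat.sqrt (order P L) + 1) :
    ¬ Unstable A B := by
  rintro ⟨A₁, B₁, hA, hB, hc, A₂', B₂', hA₂', hB₂', hD', hlt'⟩
  obtain ⟨A₂, hA₂, B₂, hB₂, hD⟩ := hD'.exists_minDom
  have hlt : A₂.card + B₂.card < A.card + B.card :=
    lt_of_le_of_lt (add_le_add (card_le_card hA₂) (card_le_card hB₂)) hlt'
  replace hA₂ := hA₂.trans hA₂'
  replace hB₂ := hB₂.trans hB₂'
  have h1 := card_le_card hA
  have h2 := card_le_card hB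
  by_cases hAA : A₁.card = A.card
  · have hA₁ : A = A₁ := eq_of_subset_of_card_le hA hAA.le
    obtain ⟨v, hv, rfl⟩ := exists_eq_insert_iff.2 ⟨hB, (by omega : B.card + 1 = B₁.card)⟩
    exact h.not_dom_of_insert_line hq5 hcard hv (hA₁ ▸ hA₂) hB₂ hlt hD
  · have hB₁ : B = B₁ := eq_of_subset_of_card_le hB (by omega)
    obtain ⟨v, hv, rfl⟩ := exists_eq_insert_iff.2 ⟨hA, (by omega : A.card + 1 = A₁.card)⟩
    refine MinDom.not_dom_of_insert_line (P := Dual L) (L := Dual P) h.dual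
      (by rw [Dual.order]; exact hq5) ?_ hv (hB₁ ▸ hB₂) hA₂ ?_ hD.dual
    · rw [Dual.order, add_comm]; exact hcard
    · exact (by omega : B₂.card + A₂.card < B.card + A.card)

end Stability

/-! ### Translation to the incidence graph and assembly of the theorem -/

section Graph

open Finset
open scoped Classical

variable {P L : Type*} [Membership P L]

/-- The vertex set with point set `A` and line set `B`. -/
def verts (A : Finset P) (B : Finset L) : Set (P ⊕ L) :=
  Sum.inl '' (A : Set P) ∪ Sum.inr '' (B : Set L)

@[simp] theorem inl_mem_verts {A : Finset P} {B : Finset L} {p : P} :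
    Sum.inl p ∈ verts A B ↔ p ∈ A := by simp [verts]

@[simp] theorem inr_mem_verts {A : Finset P} {B : Finset L} {l : L} :
    Sum.inr l ∈ verts A B ↔ l ∈ B := by simp [verts]

theorem points_verts (A : Finset P) (B : Finset L) : points (verts A B) = A := by
  ext p; simp [points]

theorem lines_verts (A : Finset P) (B : Finset L) : lines (verts A B) = B := by
  ext p; simp [lines]

theorem verts_subset_verts {A A' : Finset P} {B B' : Finset L} :
    verts A B ⊆ verts A' B' ↔ A ⊆ A' ∧ B ⊆ B' := by
  refine ⟨fun h => ⟨fun p hp => ?_, fun l hl => ?_⟩, fun h => ?_⟩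
  · exact inl_mem_verts.1 (h (inl_mem_verts.2 hp))
  · exact inr_mem_verts.1 (h (inr_mem_verts.2 hl))
  · rintro (p | l) hv
    · exact inl_mem_verts.2 (h.1 (inl_mem_verts.1 hv))
    · exact inr_mem_verts.2 (h.2 (inr_mem_verts.1 hv))

theorem ncard_verts (A : Finset P) (B : Finset L) : (verts A B).ncard = A.card + B.card := by
  rw [verts, Set.ncard_union_eq, Set.ncard_image_of_injective _ Sum.inl_injective,
    Set.ncard_image_of_injective _ Sum.inr_injective, Set.ncard_coe_finset, Set.ncard_coe_finset]
  · rw [Set.disjoint_left]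
    rintro _ ⟨p, -, rfl⟩ ⟨l, -, h⟩
    cases h

variable [Fintype P] [Fintype L]

theorem exists_verts (D : Set (P ⊕ L)) : ∃ A B, D = verts A B := by
  refine ⟨(points D).toFinset, (lines D).toFinset, ?_⟩
  ext (p | l)
  · rw [inl_mem_verts, Set.mem_toFinset]; rfl
  · rw [inr_mem_verts, Set.mem_toFinset]; rfl

theorem isDominating_verts {A : Finset P} {B : Finset L} :
    IsDominating (incidenceGraph P L) (verts A B) ↔ Dom A B := by
  constructor
  · intro h
    refine ⟨fun p hp => ?_, fun l hl => ?_⟩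
    · rcases h (Sum.inl p) with h | ⟨u | u, hu, hadj⟩
      · exact absurd (inl_mem_verts.1 h) hp
      · exact hadj.elim
      · exact ⟨u, inr_mem_verts.1 hu, hadj⟩
    · rcases h (Sum.inr l) with h | ⟨u | u, hu, hadj⟩
      · exact absurd (inr_mem_verts.1 h) hl
      · exact ⟨u, inl_mem_verts.1 hu, hadj⟩
      · exact hadj.elim
  · rintro h (p | l)
    · by_cases hp : p ∈ A
      · exact Or.inl (inl_mem_verts.2 hp)
      · obtain ⟨l, hl, hpl⟩ := h.1 p hp
        exact Or.inr ⟨Sum.inr l, inr_mem_verts.2 hl, hpl⟩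
    · by_cases hl : l ∈ B
      · exact Or.inl (inr_mem_verts.2 hl)
      · obtain ⟨p, hp, hpl⟩ := h.2 l hl
        exact Or.inr ⟨Sum.inl p, inl_mem_verts.2 hp, hpl⟩

theorem minimal_isDominating_verts {A : Finset P} {B : Finset L} :
    Minimal (IsDominating (incidenceGraph P L)) (verts A B) ↔ MinDom A B := by
  constructor
  · intro h
    refine ⟨isDominating_verts.1 h.1, fun A' hA B' hB hD => ?_⟩
    have := h.2 (isDominating_verts.2 hD) (verts_subset_verts.2 ⟨hA, hB⟩)
    obtain ⟨h1, h2⟩ := verts_subset_verts.1 this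
    exact ⟨Subset.antisymm hA h1, Subset.antisymm hB h2⟩
  · intro h
    refine ⟨isDominating_verts.2 h.1, fun D hD hsub => ?_⟩
    obtain ⟨A', B', rfl⟩ := exists_verts D
    obtain ⟨h1, h2⟩ := verts_subset_verts.1 hsub
    obtain ⟨rfl, rfl⟩ := h.2 A' h1 B' h2 (isDominating_verts.1 hD)
    exact Set.Subset.rfl

theorem isStable_verts {A : Finset P} {B : Finset L} :
    IsStable (incidenceGraph P L) (verts A B) ↔ MinDom A B ∧ ¬ Unstable A B := by
  rw [IsStable, minimal_isDominating_verts]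
  refine and_congr_right fun hM => not_congr ⟨?_, ?_⟩
  · rintro ⟨D, hD, hss, hcard, E, hE, hEdom, hlt⟩
    obtain ⟨A₁, B₁, rfl⟩ := exists_verts D
    obtain ⟨A₂, B₂, rfl⟩ := exists_verts E
    rw [ncard_verts, ncard_verts] at hcard hlt
    rw [verts_subset_verts] at hE
    have hsub := verts_subset_verts.1 hss.subset
    exact ⟨A₁, B₁, hsub.1, hsub.2, hcard, A₂, B₂, hE.1, hE.2, isDominating_verts.1 hEdom, hlt⟩
  · rintro ⟨A₁, B₁, hA, hB, hcard, A₂, B₂, hA₂, hB₂, hE, hlt⟩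
    have hsub : verts A B ⊆ verts A₁ B₁ := verts_subset_verts.2 ⟨hA, hB⟩
    refine ⟨verts A₁ B₁, isDominating_verts.2 (hM.1.mono hA hB), ?_, ?_, verts A₂ B₂,
      verts_subset_verts.2 ⟨hA₂, hB₂⟩, isDominating_verts.2 hE, ?_⟩
    · refine hsub.ssubset_of_ne fun e => ?_
      have := congrArg Set.ncard e
      rw [ncard_verts, ncard_verts] at this
      omega
    · rw [ncard_verts, ncard_verts]; exact hcard
    · rw [ncard_verts, ncard_verts]; exact hlt

variable [ProjectivePlane P L]

theorem isPrimal_verts {A : Finset P} {B : Finset L} : IsPrimal (verts A B) ↔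
    (∃ x, (order P L : ℤ) ≤ ldeg B x) ∨ ∃ l : L, (order P L : ℤ) ≤ pdeg A l := by
  rw [IsPrimal, points_verts, lines_verts]
  refine or_congr (exists_congr fun x => ?_) (exists_congr fun l => ?_)
  · have : pencil L x ∩ (B : Set L) = (B.filter (x ∈ ·) : Finset L) := by
      ext l; simp [pencil, and_comm]
    rw [this, Set.ncard_coe_finset, ldeg_eq_card, Nat.cast_le]
  · have : range P l ∩ (A : Set P) = (A.filter (· ∈ l) : Finset P) := by
      ext l; simp [range, and_comm]
    rw [this, Set.ncard_coe_finset, pdeg_eq_card, Nat.cast_le]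

/-- The list of primal minimal dominating sets, in terms of the points `A` and the lines `B`. -/
def PrimalList (q : ℕ) (A : Finset P) (B : Finset L) : Prop :=
  (A.card + B.card = 2 * q ∧ ∃ (x : P) (l : L), x ∈ l ∧ (A : Set P) = range P l \ {x} ∧
    (B : Set L) = pencil L x \ {l}) ∨
  (A.card + B.card = 2 * q + 2 ∧ ∃ (x : P) (l : L), x ∉ l ∧ (A : Set P) = range P l ∧
    (B : Set L) = pencil L x) ∨
  (((A.card + B.card : ℕ) : ℝ) = 2 * q + √(q : ℝ) + 1 ∧
    (IsBaerType (A : Set P) (B : Set L) ∨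
      IsBaerType (P := Dual L) (L := Dual P) (B : Set L) (A : Set P))) ∨
  (((A.card + B.card : ℕ) : ℝ) < 3 * q - 1 ∧
    2 * q + √(q : ℝ) + 1 < ((A.card + B.card : ℕ) : ℝ) ∧
    (¬ Unstable A B →
      IsProjectiveBlockingType (A : Set P) (B : Set L) ∨
      IsAffineBlockingType (A : Set P) (B : Set L) ∨
      IsProjectiveBlockingType (P := Dual L) (L := Dual P) (B : Set L) (A : Set P) ∨
      IsAffineBlockingType (P := Dual L) (L := Dual P) (B : Set L) (A : Set P))) ∨
  3 * (q : ℝ) - 1 ≤ ((A.card + B.card : ℕ) : ℝ)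

theorem PrimalList.of_dual {q : ℕ} {A : Finset P} {B : Finset L}
    (h : PrimalList (P := Dual L) (L := Dual P) q B A) : PrimalList q A B := by
  have hc : B.card + A.card = A.card + B.card := add_comm _ _
  rcases h with ⟨h1, l, x, h2, h3, h4⟩ | ⟨h1, l, x, h2, h3, h4⟩ | ⟨h1, h2⟩ | ⟨h1, h2, h3⟩ | h
  · exact Or.inl ⟨hc.symm.trans h1, x, l, h2, h4, h3⟩
  · exact Or.inr (Or.inl ⟨hc.symm.trans h1, x, l, h2, h4, h3⟩)
  · refine Or.inr (Or.inr (Or.inl ⟨?_, h2.symm⟩))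
    rw [← hc]; exact h1
  · refine Or.inr (Or.inr (Or.inr (Or.inl ⟨?_, ?_, fun hu => ?_⟩)))
    · rw [← hc]; exact h1
    · rw [← hc]; exact h2
    · rcases h3 (fun h => hu h.dual) with h | h | h | h
      · exact Or.inr (Or.inr (Or.inl h))
      · exact Or.inr (Or.inr (Or.inr h))
      · exact Or.inl h
      · exact Or.inr (Or.inl h)
  · refine Or.inr (Or.inr (Or.inr (Or.inr ?_)))
    rw [← hc]; exact h

theorem PencilOutcome.primalList {A : Finset P} {B : Finset L} (h : PencilOutcome A B) :
    PrimalList (order P L) A B := by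
  have hpts : ∀ l : L, ((pts P l : Finset P) : Set P) = range P l := fun l => by
    ext p; simp [range]
  have hlns : ∀ x : P, ((lns L x : Finset L) : Set L) = pencil L x := fun x => by
    ext p; simp [pencil]
  have hcast : ∀ n : ℤ, (A.card : ℤ) + B.card = 2 * order P L + 1 + n →
      ((A.card + B.card : ℕ) : ℝ) = 2 * order P L + 1 + n := fun n hn => by
    rw [← Int.cast_natCast (R := ℝ)]
    push_cast
    exact_mod_cast hn
  have hlt : ∀ n : ℤ, 0 ≤ n → (order P L : ℤ) < n ^ 2 → √(order P L : ℝ) < n := fun n hn hq => by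
    rw [Real.sqrt_lt (Nat.cast_nonneg _) (by exact_mod_cast hn)]
    exact_mod_cast hq
  by_cases hlarge : 3 * (order P L : ℝ) - 1 ≤ ((A.card + B.card : ℕ) : ℝ)
  · exact Or.inr (Or.inr (Or.inr (Or.inr hlarge)))
  have hlarge' := not_le.1 hlarge
  cases h with
  | erased x l hxl hA hB =>
    refine Or.inl ⟨?_, x, l, hxl, ?_, ?_⟩
    · rw [hA, hB, card_erase_of_mem (mem_pts.2 hxl), card_erase_of_mem (mem_lns.2 hxl), card_pts,
        card_lns]
      simp only [Nat.add_sub_cancel]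
      ring
    · rw [hA, coe_erase, hpts]
    · rw [hB, coe_erase, hlns]
  | full x l hxl hA hB =>
    refine Or.inr (Or.inl ⟨?_, x, l, hxl, ?_, ?_⟩)
    · rw [hA, hB, card_pts, card_lns]; ring
    · rw [hA, hpts]
    · rw [hB, hlns]
  | large h =>
    refine absurd ?_ hlarge
    exact_mod_cast (by exact_mod_cast h :
      ((3 * (order P L : ℤ) - 1 : ℤ) : ℝ) ≤ ((A.card + B.card : ℤ) : ℝ))
  | projective x n hn hn0 hB htype hpdeg hq heq =>
    rcases hq.eq_or_lt with hq | hq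
    · refine Or.inr (Or.inr (Or.inl ⟨?_, Or.inl (heq hq)⟩))
      have h1 : (order P L : ℝ) = (n : ℝ) ^ 2 := by exact_mod_cast hq
      have h2 : √(order P L : ℝ) = n := by
        rw [h1]; exact Real.sqrt_sq (by exact_mod_cast hn0)
      rw [hcast n hn, h2]; ring
    · refine Or.inr (Or.inr (Or.inr (Or.inl ⟨hlarge', ?_, fun _ => Or.inl htype⟩)))
      rw [hcast n hn]
      linarith [hlt n hn0 hq]
  | affine n hn hn0 hq htype =>
    refine Or.inr (Or.inr (Or.inr (Or.inl ⟨hlarge', ?_, fun hu => ?_⟩)))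
    · rw [hcast n hn]
      linarith [hlt n hn0 hq]
    · exact Or.inr (Or.inl (htype.resolve_right hu))

theorem MinDom.primalList {A : Finset P} {B : Finset L} (h : MinDom A B) (hq5 : 5 ≤ order P L)
    (hprimal : IsPrimal (verts A B)) : PrimalList (order P L) A B := by
  rcases isPrimal_verts.1 hprimal with ⟨x, hx⟩ | ⟨l, hl⟩
  · exact (h.pencilOutcome hq5 hx).primalList
  · refine PrimalList.of_dual ?_
    rw [← Dual.order (P := P) (L := L)]
    exact (MinDom.pencilOutcome (P := Dual L) (L := Dual P) h.dual
      (by rw [Dual.order]; exact hq5) (x := l) (by rw [Dual.order]; exact hl)).primalList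

end Graph

end DomPlane

theorem theorem1p2 {P L : Type*} [Membership P L] [Finite P] [Finite L] [ProjectivePlane P L]
    (q : ℕ) (hq : order P L = q) (hq5 : 5 ≤ q)
    (D : Set (P ⊕ L)) (hD : Minimal (DomPlane.IsDominating (DomPlane.incidenceGraph P L)) D) :
    ((D.ncard : ℝ) ≤ 2 * q + √(q : ℝ) + 1 → DomPlane.IsStable (DomPlane.incidenceGraph P L) D) ∧
    ((DomPlane.IsPrimal D ∧
        -- (i)
        ((D.ncard = 2 * q ∧ ∃ (p : P) (l : L), p ∈ l ∧
            D = Sum.inl '' (DomPlane.range P l \ {p}) ∪ Sum.inr '' (DomPlane.pencil L p \ {l})) ∨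
        -- (ii)
        (D.ncard = 2 * q + 2 ∧ ∃ (p : P) (l : L), p ∉ l ∧
            D = Sum.inl '' DomPlane.range P l ∪ Sum.inr '' DomPlane.pencil L p) ∨
        -- (iii)
        ((D.ncard : ℝ) = 2 * q + √(q : ℝ) + 1 ∧
            (DomPlane.IsBaerType (DomPlane.points D) (DomPlane.lines D) ∨
              DomPlane.IsBaerType (P := Dual L) (L := Dual P)
                (DomPlane.lines D) (DomPlane.points D))) ∨
        -- (iv)
        ((D.ncard : ℝ) < 3 * q - 1 ∧ 2 * q + √(q : ℝ) + 1 < (D.ncard : ℝ) ∧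
            (DomPlane.IsStable (DomPlane.incidenceGraph P L) D →
              DomPlane.IsProjectiveBlockingType (DomPlane.points D) (DomPlane.lines D) ∨
              DomPlane.IsAffineBlockingType (DomPlane.points D) (DomPlane.lines D) ∨
              DomPlane.IsProjectiveBlockingType (P := Dual L) (L := Dual P)
                (DomPlane.lines D) (DomPlane.points D) ∨
              DomPlane.IsAffineBlockingType (P := Dual L) (L := Dual P)
                (DomPlane.lines D) (DomPlane.points D))) ∨
        -- (v)
        3 * (q : ℝ) - 1 ≤ (D.ncard : ℝ))) ∨
      (¬ DomPlane.IsPrimal D ∧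
        -- (vi)
        (81 < q → 2 * q + 2 * ⌊√(q : ℝ)⌋₊ + 2 ≤ D.ncard))) := by
  classical
  cases nonempty_fintype P
  cases nonempty_fintype L
  subst hq
  obtain ⟨A, B, rfl⟩ := DomPlane.exists_verts D
  have hM := DomPlane.minimal_isDominating_verts.1 hD
  rw [DomPlane.ncard_verts, DomPlane.points_verts, DomPlane.lines_verts,
    DomPlane.isStable_verts]
  refine ⟨fun hcard => ⟨hM, hM.not_unstable hq5 ?_⟩, ?_⟩
  -- The size is an integer, so `√q` may be replaced by its integer part.
  · have h1 : ((A.card : ℤ) + B.card - (2 * order P L + 1)) ≤ ⌊√(order P L : ℝ)⌋ := by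
      rw [Int.le_floor]
      push_cast at hcard ⊢
      linarith
    rw [Real.floor_real_sqrt_eq_nat_sqrt] at h1
    linarith
  · by_cases hprimal : DomPlane.IsPrimal (DomPlane.verts A B)
    · left
      refine ⟨hprimal, ?_⟩
      have hdual : ∀ F : Set (Dual L) → Set (Dual P) → Prop,
          F (DomPlane.lines (DomPlane.verts A B)) (DomPlane.points (DomPlane.verts A B)) =
            F (B : Set L) (A : Set P) := fun F =>
        congrArg₂ F (DomPlane.lines_verts A B) (DomPlane.points_verts A B)
      rcases hM.primalList hq5 hprimal with ⟨h1, x, l, hxl, hA, hB⟩ | ⟨h1, x, l, hxl, hA, hB⟩ |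
        h | ⟨h1, h2, h3⟩ | h
      · exact Or.inl ⟨h1, x, l, hxl, by rw [DomPlane.verts, hA, hB]⟩
      · exact Or.inr (Or.inl ⟨h1, x, l, hxl, by rw [DomPlane.verts, hA, hB]⟩)
      · exact Or.inr (Or.inr (Or.inl ⟨h.1, h.2.imp_right (hdual DomPlane.IsBaerType).mpr⟩))
      · refine Or.inr (Or.inr (Or.inr (Or.inl ⟨h1, h2, fun hs => ?_⟩)))
        exact (h3 hs.2).imp_right (Or.imp_right (Or.imp
          (hdual DomPlane.IsProjectiveBlockingType).mpr
          (hdual DomPlane.IsAffineBlockingType).mpr))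
      · exact Or.inr (Or.inr (Or.inr (Or.inr h)))
    · right
      refine ⟨hprimal, fun hq81 => ?_⟩
      rw [DomPlane.isPrimal_verts] at hprimal
      push Not at hprimal
      rw [Real.nat_floor_real_sqrt_eq_nat_sqrt]
      exact DomPlane.nonprimal_card_ge hM.1 hq81.le
        (fun x => by have := hprimal.1 x; omega) (fun l => by have := hprimal.2 l; omega)
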